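/- **Conventions.** Positions in a string $s=s[1]\cdots s[n]$ are numbered from $1$, and $s[i\,..\,j)$ denotes $s[i]\cdots s[j-1]$. Write $\lg x=\max(1,\log_2 x)$. A non-empty substring $s[q\,..\,q+t)$ is a *right closed repeat* with *next occurrence* at position $p>q$ if it occurs in $s$ at $p$ and at none of the positions $q+1,\dots,p-1$, and either $s[q+t]\ne s[p+t]$ or $p+t=n+1$. The *LZ77 parsing* of a string $u$ is the decomposition $u=f_1\cdots f_z$ built greedily from left to right: if $u[1\,..\,p)=f_1\cdots f_{m-1}$, then $f_m$ is the letter $u[p]$ if it does not occur in $u[1\,..\,p)$, and otherwise the longest substring that starts at $p$ and also occurs at some position $q<p$ of $u$ (overlaps allowed). The *rightmost* LZ77 parsing gives with each phrase its start, its length and the maximal position $q<p$ of $u$ at which the phrase occurs (or the information that there is none). The machine is the word RAM with $w$-bit words: unit-cost arithmetic, bitwise operations, shifts, comparisons, loads and stores, a fixed number of registers, and an output to which words are appended. **Theorem.** There are three fixed word-RAM programs and constants $c,C$ such that for every string $s$ of length $n$ over any alphabet and every word size $w\ge c\lg n$ there is a data structure (a memory content) of at most $C\,n\lg n$ words of $w$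 bits with the following properties. Every query leaves the data structure unchanged. 1. For each position $p\in[1,n]$ it stores, at an address found in memory cell $p$, the list $(q_1,t_1),\dots,(q_k,t_k)$, $t_1<\dots<t_k$, of all pairs such that $s[q_x\,..\,q_x+t_x)$ is a right closed repeat whose next occurrence is at $p$. 2. Each of these lists supports successor search in both coordinates. Given $1\le i<p\le n$, the first program outputs the pair of the list of $p$ with the least $q_x\ge i$ (or reports that there is none) in time at most $C\lg\lg(p-i)$. Given $p,m\in[1,n]$, the second program outputs the pair of the list of $p$ with the least $t_x\ge m$ (or reports that there is none) in time at most $C\lg\lg m$. 3. Given $i\ge1$ and $\ell\ge1$ with $i+\ell\le n+1$, the third program outputs the rightmost LZ77 parsing of $u=s[i\,..\,i+\ell)$, with positions relative to $u$, in time at most $C\,z\lg\lg\ell$, where $z$ is the number of phrases. -/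

import Mathlib

namespace RightmostLZ

/-! ## Strings

Positions in strings are numbered from `1`, so position `p` of `s` is the list index `p - 1`. -/

variable {α : Type*}

/-- The substring `s[p .. p + m)`. It has length `m` when `1 ≤ p` and `p + m ≤ |s| + 1`. -/
def substr (s : List α) (p m : ℕ) : List α := (s.drop (p - 1)).take m

/-- `s[q .. q + t)` is a right closed repeat of `s` and its next occurrence is at position `p`:
it is non-empty, occurs at `p > q`, does not occur at `q + 1, …, p - 1`, and either the next
occurrence is a suffix of `s` or the letters `s[q + t]` and `s[p + t]` differ. -/
def IsRightClosedRepeat (s : List α) (q t p : ℕ) : Prop :=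
  1 ≤ q ∧ 1 ≤ t ∧ q < p ∧ p + t ≤ s.length + 1 ∧
  substr s p t = substr s q t ∧
  (∀ r, q < r → r < p → substr s r t ≠ substr s q t) ∧
  (substr s (q + t) 1 ≠ substr s (p + t) 1 ∨ p + t = s.length + 1)

/-- The pairs `(q, t)` such that `s[q .. q + t)` is a right closed repeat whose next occurrence
is at position `p`. -/
def repeatsInto (s : List α) (p : ℕ) : Set (ℕ × ℕ) := {x | IsRightClosedRepeat s x.1 x.2 p}

/-! ## The rightmost LZ77 parsing -/

/-- The positions `q < p` at which `u[p .. p + m)` occurs in `u` (the occurrence may overlap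
`u[p .. p + m)`). -/
def earlierOcc (u : List α) (p m : ℕ) : Set ℕ :=
  {q | 1 ≤ q ∧ q < p ∧ substr u q m = substr u p m}

/-- If `u[1 .. p)` is already parsed, then the next LZ77 phrase is `u[p .. p + m)`: either a letter
that does not occur in `u[1 .. p)`, or the longest non-empty substring that starts at `p` and also
occurs at some earlier position. -/
def IsLZ77Phrase (u : List α) (p m : ℕ) : Prop :=
  (m = 1 ∧ p ≤ u.length ∧ earlierOcc u p 1 = ∅) ∨
  IsGreatest {k | 1 ≤ k ∧ p + k ≤ u.length + 1 ∧ (earlierOcc u p k).Nonempty} m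

/-- `src` is the maximal earlier position at which `u[p .. p + m)` occurs, if there is any. -/
def IsRightmostSource (u : List α) (p m : ℕ) : Option ℕ → Prop
  | none => earlierOcc u p m = ∅
  | some q => IsGreatest (earlierOcc u p m) q

/-- A reported phrase `u[start .. start + len)` together with its source, if there is one. -/
structure Phrase where
  start : ℕ
  len : ℕ
  source : Option ℕ

/-- The list of phrases is the rightmost LZ77 parsing of the suffix of `u` that starts at position
`p`, the prefix `u[1 .. p)` being already parsed. -/
def IsRightmostLZ77From (u : List α) : ℕ → List Phrase → Prop
  | p, [] => p = u.length + 1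
  | p, f :: fs =>
      f.start = p ∧ IsLZ77Phrase u p f.len ∧ IsRightmostSource u p f.len f.source ∧
        IsRightmostLZ77From u (p + f.len) fs

/-- The list of phrases is the rightmost LZ77 parsing of `u`. -/
def IsRightmostLZ77 (u : List α) (fs : List Phrase) : Prop := IsRightmostLZ77From u 1 fs

/-- A phrase is reported as three words; the source `0` says that there is no earlier
occurrence. -/
def Phrase.words (f : Phrase) : List ℕ := [f.start, f.len, f.source.getD 0]

/-! ## The word RAM

Words are the natural numbers below `2 ^ w`. There are registers (a program uses a fixed finite
number of them), a random access memory and a write-only output. Each elementary instruction and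
each test of a branch or a loop takes one unit of time. -/

/-- The binary operations on words. -/
inductive BinOp
  | add | sub | mul | div | mod | and | or | xor | shl | shr | lt | eq

/-- The value of an operation on `w`-bit words (arithmetic is modulo `2 ^ w`). -/
def BinOp.eval (w : ℕ) : BinOp → ℕ → ℕ → ℕ
  | .add, a, b => (a + b) % 2 ^ w
  | .sub, a, b => (a + 2 ^ w - b) % 2 ^ w
  | .mul, a, b => (a * b) % 2 ^ w
  | .div, a, b => a / b
  | .mod, a, b => a % b
  | .and, a, b => a &&& b
  | .or, a, b => a ||| b
  | .xor, a, b => a ^^^ b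
  | .shl, a, b => (a * 2 ^ b) % 2 ^ w
  | .shr, a, b => a / 2 ^ b
  | .lt, a, b => if a < b then 1 else 0
  | .eq, a, b => if a = b then 1 else 0

/-- Programs. The arguments are numbers of registers, except for the literal in `const`. -/
inductive Prog
  | skip
  /-- register `d` receives the literal `c` -/
  | const (d c : ℕ)
  /-- register `d` receives register `a` -/
  | move (d a : ℕ)
  /-- register `d` receives the value of the operation on registers `a` and `b` -/
  | op (o : BinOp) (d a b : ℕ)
  /-- register `d` receives the memory cell whose address is in register `a` -/
  | load (d a : ℕ)
  /-- the memory cell whose address is in register `a` receives register `b` -/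
  | store (a b : ℕ)
  /-- register `a` is appended to the output -/
  | emit (a : ℕ)
  | seq (P Q : Prog)
  /-- run `P` if register `a` is non-zero, and `Q` otherwise -/
  | cond (a : ℕ) (P Q : Prog)
  /-- run `P` as long as register `a` is non-zero -/
  | loop (a : ℕ) (P : Prog)

/-- A configuration of the machine. The size of the memory is the length of `mem`. -/
structure State where
  regs : ℕ → ℕ
  mem : List ℕ
  out : List ℕ

/-- Assignment to a register. -/
def State.set (σ : State) (d v : ℕ) : State := { σ with regs := Function.update σ.regs d v }

/-- `Exec w P σ k τ`: with `w`-bit words, the program `P` started in `σ` halts in `τ` after exactly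
`k` units of time. An access outside the memory has no successor configuration. -/
inductive Exec (w : ℕ) : Prog → State → ℕ → State → Prop
  | skip (σ : State) : Exec w .skip σ 1 σ
  | const (σ : State) (d c : ℕ) : Exec w (.const d c) σ 1 (σ.set d (c % 2 ^ w))
  | move (σ : State) (d a : ℕ) : Exec w (.move d a) σ 1 (σ.set d (σ.regs a))
  | op (σ : State) (o : BinOp) (d a b : ℕ) :
      Exec w (.op o d a b) σ 1 (σ.set d (o.eval w (σ.regs a) (σ.regs b)))
  | load (σ : State) (d a v : ℕ) (h : σ.mem[σ.regs a]? = some v) :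
      Exec w (.load d a) σ 1 (σ.set d v)
  | store (σ : State) (a b : ℕ) (h : σ.regs a < σ.mem.length) :
      Exec w (.store a b) σ 1 { σ with mem := σ.mem.set (σ.regs a) (σ.regs b) }
  | emit (σ : State) (a : ℕ) : Exec w (.emit a) σ 1 { σ with out := σ.out ++ [σ.regs a] }
  | seq {P Q : Prog} {σ τ υ : State} {k l : ℕ} (hP : Exec w P σ k τ) (hQ : Exec w Q τ l υ) :
      Exec w (.seq P Q) σ (k + l) υ
  | cond_true {a : ℕ} {P Q : Prog} {σ τ : State} {k : ℕ} (h : σ.regs a ≠ 0)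
      (hP : Exec w P σ k τ) : Exec w (.cond a P Q) σ (k + 1) τ
  | cond_false {a : ℕ} {P Q : Prog} {σ τ : State} {k : ℕ} (h : σ.regs a = 0)
      (hQ : Exec w Q σ k τ) : Exec w (.cond a P Q) σ (k + 1) τ
  | loop_done {a : ℕ} {P : Prog} {σ : State} (h : σ.regs a = 0) : Exec w (.loop a P) σ 1 σ
  | loop_step {a : ℕ} {P : Prog} {σ τ υ : State} {k l : ℕ} (h : σ.regs a ≠ 0)
      (hP : Exec w P σ k τ) (hL : Exec w (.loop a P) τ l υ) :
      Exec w (.loop a P) σ (k + l + 1) υ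

/-- The initial configuration of a query with the arguments `x` and `y`: they are in the registers
`0` and `1`, the other registers are zero, and the output is empty. -/
def initState (mem : List ℕ) (x y : ℕ) : State where
  regs := fun r => if r = 0 then x else if r = 1 then y else 0
  mem := mem
  out := []

/-- On the memory `mem` and the arguments `x`, `y`, the program `P` outputs `out` within time `T`
and leaves the memory as it was (so that any number of queries can follow). -/
def Answers (w : ℕ) (P : Prog) (mem : List ℕ) (x y : ℕ) (out : List ℕ) (T : ℝ) : Prop :=
  ∃ (k : ℕ) (τ : State), Exec w P (initState mem x y) k τ ∧ τ.mem = mem ∧ τ.out = out ∧ (k : ℝ) ≤ T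

/-! ## The data structure -/

/-- The binary logarithm, replaced by `1` where it is smaller. -/
noncomputable def lg (x : ℝ) : ℝ := max 1 (Real.logb 2 x)

/-- For every position `p` of `s`, the memory cell `p` holds the address of the list of all right
closed repeats whose next occurrence is at `p`: the number `k` of them, followed by
`q₁, t₁, …, qₖ, tₖ` in the increasing order of the lengths `t₁ < ⋯ < tₖ`. -/
def StoresRepeats (s : List α) (mem : List ℕ) : Prop :=
  ∀ p, 1 ≤ p → p ≤ s.length → ∃ (a : ℕ) (L : List (ℕ × ℕ)),
    mem[p]? = some a ∧
    L.Pairwise (fun x y => x.2 < y.2) ∧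
    (∀ x, x ∈ L ↔ x ∈ repeatsInto s p) ∧
    (L.length :: L.flatMap fun x => [x.1, x.2]) <+: mem.drop a

/-- `r` is an element of `S` whose key is the least one that is at least `b`, if there is any. -/
def IsFirstFrom (S : Set (ℕ × ℕ)) (key : ℕ × ℕ → ℕ) (b : ℕ) : Option (ℕ × ℕ) → Prop
  | none => ∀ x ∈ S, key x < b
  | some x => x ∈ S ∧ b ≤ key x ∧ ∀ y ∈ S, b ≤ key y → key x ≤ key y

/-- A repeat is reported as two words; `0, 0` says that there is none. -/
def repeatWords (r : Option (ℕ × ℕ)) : List ℕ := [(r.getD (0, 0)).1, (r.getD (0, 0)).2]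

end RightmostLZ

open RightmostLZ

/-! Combinatorics. An earlier occurrence of a substring starting at `p` can be moved to the last one
before `p` and then extended to the right as far as it matches; this gives a listed pair with no
smaller `q` and no smaller `t` (`exists_isRightClosedRepeat`). Each list is a staircase: as `t`
increases, `q` decreases (`IsRightClosedRepeat.lt_of_lt`). So the pair with the least `q ≥ i` is
also the longest one with `q ≥ i`. If it fits into `s[i .. i + ℓ)`, it is the next phrase with its
rightmost source. If it sticks out, the phrase is the whole rest, and the pair with the least `t`
covering the rest gives the rightmost source. Without such a pair the phrase is a new letter. Two
successor searches per phrase suffice.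

Size. For a repeat `(q, t)` into `p`, the one-letter extensions at `q` and at `p` differ, so one of
them has at most half of the occurrences of the common prefix of length `t`. A suffix sees at most
`log n` such halvings, and a repeat is determined by `(q, t)` as well as by `(p, t)`; hence there
are at most `2 n log n` repeats (`sum_card_repeatsFinset_le`).

Search. The time must depend on the searched value `y`, not on `n`. With `level y` about `log log
y`, a key of level `j` enters the trie only if its index is a multiple of `2 ^ j`, and it costs `2 ^
j` prefixes, so a list of `k` keys below `2 ^ g` needs `k + O(g)` entries (`card_trieEntries_le`).
Doubling finds `2 ^ level y`, binary search over depths finds the first stored prefix of `y` and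
thereby the preceding represented key (`trieVal_eq`), and the rank lies in a window of `2 ^ level y`
indices after it (`le_of_repBelow_add_le`), where binary search ends (`rankProg_spec`).

All tries share one static two-level hash table (`exists_perfect_hash`). The programs are verified
in a small calculus of timed symbolic execution, `WP`; `exists_memory` builds the memory image. -/

namespace RightmostLZ
open Finset

/-! ### Right closed repeats: the staircase structure. -/

section Strings
variable {α : Type*} {s : List α} {i l p q r t m k : ℕ}

theorem length_substr (hp : 1 ≤ p) (h : p + m ≤ s.length + 1) : (substr s p m).length = m := by
  simp only [substr, List.length_take, List.length_drop]; omega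

theorem take_substr (h : m ≤ k) : (substr s p k).take m = substr s p m := by
  simp [substr, List.take_take, h]

theorem substr_eq_of_le (h : substr s p k = substr s q k) (hm : m ≤ k) :
    substr s p m = substr s q m := by
  rw [← take_substr hm, h, take_substr hm]

theorem substr_succ (hq : 1 ≤ q) : substr s q (t + 1) = substr s q t ++ substr s (q + t) 1 := by
  have h : q + t - 1 = (q - 1) + t := by omega
  simp only [substr]
  rw [h, List.take_add, List.drop_drop]

theorem substr_substr (hi : 1 ≤ i) (hq : 1 ≤ q) (h : q + m ≤ l + 1) :
    substr (substr s i l) q m = substr s (i + q - 1) m := by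
  have h1 : i + q - 1 - 1 = (i - 1) + (q - 1) := by omega
  simp only [substr]
  rw [h1, List.drop_take, List.take_take, List.drop_drop, min_eq_left (by omega)]

/-- `substr` truncates at the end of `s`, so when the occurrence at `p` is a suffix the two
substrings of length `t + 1` already differ in length. Both alternatives of the definition thus
become one inequality. -/
theorem isRightClosedRepeat_iff : IsRightClosedRepeat s q t p ↔
    1 ≤ q ∧ 1 ≤ t ∧ q < p ∧ p + t ≤ s.length + 1 ∧ substr s p t = substr s q t ∧
    (∀ r, q < r → r < p → substr s r t ≠ substr s q t) ∧
    substr s p (t + 1) ≠ substr s q (t + 1) := by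
  unfold IsRightClosedRepeat
  constructor
  · rintro ⟨h1, h2, h3, h4, h5, h6, h7⟩
    refine ⟨h1, h2, h3, h4, h5, h6, fun h => ?_⟩
    rcases h7 with h7 | h7
    · rw [substr_succ (by omega), substr_succ h1, h5] at h
      exact h7 (List.append_cancel_left h).symm
    · have h8 := length_substr (s := s) (p := q) (m := t + 1) h1 (by omega)
      rw [← h] at h8
      simp only [substr, List.length_take, List.length_drop] at h8
      omega
  · rintro ⟨h1, h2, h3, h4, h5, h6, h7⟩
    refine ⟨h1, h2, h3, h4, h5, h6, ?_⟩
    by_contra! h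
    apply h7
    rw [substr_succ (by omega), substr_succ h1, h5, h.1]

/-- If `q' = q`, the longer match contradicts right closedness of the shorter one; if `q < q'`, a
prefix of the longer match occurs strictly between `q` and `p`. -/
theorem IsRightClosedRepeat.lt_of_lt {q' t' : ℕ} (h : IsRightClosedRepeat s q t p)
    (h' : IsRightClosedRepeat s q' t' p) (ht : t < t') : q' < q := by
  rw [isRightClosedRepeat_iff] at h h'
  obtain ⟨h1, h2, h3, h4, h5, h6, h7⟩ := h
  obtain ⟨-, -, h3', -, h5', -, -⟩ := h'
  by_contra! hq
  rcases hq.eq_or_lt with rfl | hq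
  · exact h7 (substr_eq_of_le h5' ht)
  · exact h6 _ hq h3' ((substr_eq_of_le h5' ht.le).symm.trans h5)

/-- Take the last earlier occurrence, then its longest match. An occurrence of the longer string in
between would also be one of the shorter string, later than the last. -/
theorem exists_isRightClosedRepeat (hq : 1 ≤ q) (ht : 1 ≤ t) (hqp : q < p)
    (hp : p + t ≤ s.length + 1) (h : substr s q t = substr s p t) :
    ∃ q' t', IsRightClosedRepeat s q' t' p ∧ q ≤ q' ∧ t ≤ t' := by
  classical
  let Q : ℕ → Prop := fun r => r < p ∧ substr s r t = substr s p t
  obtain ⟨q', hq', hmax⟩ : ∃ q', Q q' ∧ ∀ r, q' < r → ¬ Q r :=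
    ⟨Nat.findGreatest Q p, Nat.findGreatest_spec hqp.le ⟨hqp, h⟩, fun r hr hQ =>
      absurd (Nat.le_findGreatest (P := Q) hQ.1.le hQ) (by omega)⟩
  have hle : q ≤ q' := by by_contra! h'; exact hmax _ h' ⟨hqp, h⟩
  let R : ℕ → Prop := fun r => p + r ≤ s.length + 1 ∧ substr s q' r = substr s p r
  obtain ⟨t', ht', hmax'⟩ : ∃ t', R t' ∧ ∀ r, t' < r → ¬ R r :=
    ⟨Nat.findGreatest R (s.length + 1), Nat.findGreatest_spec (P := R) (m := t) (by omega) ⟨hp, hq'.2⟩,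
      fun r hr hR => absurd (Nat.le_findGreatest (P := R) (by have := hR.1; omega) hR) hr.not_ge⟩
  have hle' : t ≤ t' := by by_contra! h'; exact hmax' _ h' ⟨hp, hq'.2⟩
  refine ⟨q', t', ⟨by omega, by omega, hq'.1, ht'.1, ht'.2.symm, fun r hr hr' he => ?_, ?_⟩, hle, hle'⟩
  · exact hmax r hr ⟨hr', (substr_eq_of_le (he.trans ht'.2) hle')⟩
  · by_contra! hc
    refine hmax' (t' + 1) (by omega) ⟨by have := ht'.1; omega, ?_⟩
    rw [substr_succ (q := q') (by omega), substr_succ (q := p) (by omega), ht'.2, hc.1]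

/-- Together with `right_unique` this makes the charging of repeats to pairs `(p, t)` and `(q, t)`
injective. -/
theorem IsRightClosedRepeat.left_unique {q' : ℕ} (h : IsRightClosedRepeat s q t p)
    (h' : IsRightClosedRepeat s q' t p) : q = q' := by
  obtain ⟨-, -, h3, -, h5, h6, -⟩ := h
  obtain ⟨-, -, h3', -, h5', h6', -⟩ := h'
  rcases lt_trichotomy q q' with hq | hq | hq
  · exact absurd (h5'.symm.trans h5) (h6 _ hq h3')
  · exact hq
  · exact absurd (h5.symm.trans h5') (h6' _ hq h3)

theorem IsRightClosedRepeat.right_unique {p' : ℕ} (h : IsRightClosedRepeat s q t p)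
    (h' : IsRightClosedRepeat s q t p') : p = p' := by
  obtain ⟨-, -, h3, -, h5, h6, -⟩ := h
  obtain ⟨-, -, h3', -, h5', h6', -⟩ := h'
  rcases lt_trichotomy p p' with hp | hp | hp
  · exact absurd h5 (h6' _ h3 hp)
  · exact hp
  · exact absurd h5' (h6 _ h3' hp)

/-! ### Counting the repeats by halving arguments. -/

/-- The right closed repeats with next occurrence at `p`, as a finite set. -/
noncomputable def repeatsFinset (s : List α) (p : ℕ) : Finset (ℕ × ℕ) :=
  open Classical in
  (range (s.length + 1) ×ˢ range (s.length + 1)).filter fun x => x ∈ repeatsInto s p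

open Classical in
theorem mem_repeatsFinset {x : ℕ × ℕ} : x ∈ repeatsFinset s p ↔ IsRightClosedRepeat s x.1 x.2 p := by
  rw [repeatsFinset, Finset.mem_filter]
  simp only [repeatsInto, mem_product, Finset.mem_range, Set.mem_ofPred_eq, and_iff_right_iff_imp]
  rintro ⟨h1, h2, h3, h4, -⟩
  omega

/-- The number of positions at which the substring of length `t` at position `x` occurs. -/
noncomputable def numOcc (s : List α) (x t : ℕ) : ℕ :=
  open Classical in #{y ∈ Icc 1 s.length | substr s y t = substr s x t}

/-- The lengths at which the number of occurrences of the prefixes of a suffix is halved. -/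
noncomputable def halvings (s : List α) (x : ℕ) : Finset ℕ :=
  {t ∈ range (s.length + 1) | 2 * numOcc s x (t + 1) ≤ numOcc s x t}

theorem numOcc_anti (x : ℕ) : Antitone (numOcc s x) := by
  classical
  intro t t' h
  unfold numOcc
  refine card_le_card fun y => ?_
  simp only [Finset.mem_filter]
  exact fun hy => ⟨hy.1, substr_eq_of_le hy.2 h⟩

theorem two_pow_card_halvings_mul_le {c : ℕ → ℕ} (hc : Antitone c) (N : ℕ) :
    2 ^ #{t ∈ range N | 2 * c (t + 1) ≤ c t} * c N ≤ c 0 := by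
  induction N with
  | zero => simp
  | succ N ih =>
    rw [range_add_one, filter_insert]
    split_ifs with h
    · rw [card_insert_of_notMem (by simp), pow_succ]
      calc _ = 2 ^ #{t ∈ range N | 2 * c (t + 1) ≤ c t} * (2 * c (N + 1)) := by ring
        _ ≤ _ := (Nat.mul_le_mul_left _ h).trans ih
    · exact (Nat.mul_le_mul_left _ (hc (Nat.le_succ N))).trans ih

/-- The count starts at no more than `n` and stays at least `1`, because position `p` always matches
itself. -/
theorem card_halvings_le (hp : 1 ≤ p) (hp' : p ≤ s.length) : #(halvings s p) ≤ Nat.log 2 s.length := by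
  classical
  have h1 : 1 ≤ numOcc s p (s.length + 1) :=
    card_pos.2 ⟨p, by simp [hp, hp']⟩
  have h2 : numOcc s p 0 ≤ s.length := (card_filter_le _ _).trans (by simp)
  have h3 := two_pow_card_halvings_mul_le (numOcc_anti (s := s) p) (s.length + 1)
  refine Nat.le_log_of_pow_le (by norm_num) ?_
  calc 2 ^ #(halvings s p) ≤ 2 ^ #(halvings s p) * numOcc s p (s.length + 1) :=
        Nat.le_mul_of_pos_right _ h1
    _ ≤ _ := h3.trans h2

/-- The two extensions of length `t + 1` have disjoint sets of occurrences, both contained in the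
occurrences of the common prefix; the smaller set is at most half of it. -/
theorem IsRightClosedRepeat.mem_halvings (h : IsRightClosedRepeat s q t p) :
    t ∈ halvings s q ∨ t ∈ halvings s p := by
  classical
  rw [isRightClosedRepeat_iff] at h
  obtain ⟨h1, h2, h3, h4, h5, h6, h7⟩ := h
  simp only [halvings, Finset.mem_filter, Finset.mem_range]
  have ht : t < s.length + 1 := by omega
  have hsum : numOcc s q (t + 1) + numOcc s p (t + 1) ≤ numOcc s q t := by
    unfold numOcc
    rw [← card_union_of_disjoint]
    · refine card_le_card fun y => ?_
      simp only [Finset.mem_union, Finset.mem_filter]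
      rintro (h | h)
      · exact ⟨h.1, substr_eq_of_le h.2 (by omega)⟩
      · exact ⟨h.1, (substr_eq_of_le h.2 (by omega)).trans h5⟩
    · rw [Finset.disjoint_left]
      simp only [Finset.mem_filter]
      exact fun y h h' => h7 (h'.2.symm.trans h.2)
  have heq : numOcc s q t = numOcc s p t := by unfold numOcc; rw [h5]
  omega

theorem sum_card_repeatsFinset_le :
    ∑ p ∈ Icc 1 s.length, #(repeatsFinset s p) ≤ 2 * (s.length * Nat.log 2 s.length) := by
  classical
  set T := (Icc 1 s.length).sigma (repeatsFinset s) with hT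
  have hH : #((Icc 1 s.length).sigma (halvings s)) ≤ s.length * Nat.log 2 s.length := by
    rw [card_sigma]
    refine (sum_le_card_nsmul _ _ (Nat.log 2 s.length) fun x hx => ?_).trans (by simp)
    exact card_halvings_le (mem_Icc.1 hx).1 (mem_Icc.1 hx).2
  have h1 : #{x ∈ T | x.2.2 ∈ halvings s x.2.1} ≤ #((Icc 1 s.length).sigma (halvings s)) := by
    refine card_le_card_of_injOn (fun x => ⟨x.2.1, x.2.2⟩) ?_ ?_
    · rintro ⟨p, q, t⟩ hx
      simp only [hT, coe_filter, mem_sigma, mem_repeatsFinset, Set.mem_ofPred_eq, mem_Icc] at hx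
      have := hx.1.2.1
      have := hx.1.2.2.2.1
      simp only [coe_sigma, Set.mem_sigma_iff, Finset.mem_coe, mem_Icc]
      exact ⟨by omega, hx.2⟩
    · rintro ⟨p, q, t⟩ hx ⟨p', q', t'⟩ hx' h
      simp only [hT, coe_filter, mem_sigma, mem_repeatsFinset, Set.mem_ofPred_eq] at hx hx'
      simp only [Sigma.mk.injEq, heq_eq_eq] at h
      obtain ⟨rfl, rfl⟩ := h
      rw [hx.1.2.right_unique hx'.1.2]
  have h2 : #{x ∈ T | x.2.2 ∈ halvings s x.1} ≤ #((Icc 1 s.length).sigma (halvings s)) := by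
    refine card_le_card_of_injOn (fun x => ⟨x.1, x.2.2⟩) ?_ ?_
    · rintro ⟨p, q, t⟩ hx
      simp only [hT, coe_filter, mem_sigma, mem_repeatsFinset, Set.mem_ofPred_eq] at hx
      simp only [coe_sigma, Set.mem_sigma_iff, Finset.mem_coe]
      exact ⟨hx.1.1, hx.2⟩
    · rintro ⟨p, q, t⟩ hx ⟨p', q', t'⟩ hx' h
      simp only [hT, coe_filter, mem_sigma, mem_repeatsFinset, Set.mem_ofPred_eq] at hx hx'
      simp only [Sigma.mk.injEq, heq_eq_eq] at h
      obtain ⟨rfl, rfl⟩ := h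
      rw [hx.1.2.left_unique hx'.1.2]
  have h3 : #T ≤ #{x ∈ T | x.2.2 ∈ halvings s x.2.1} + #{x ∈ T | x.2.2 ∈ halvings s x.1} := by
    refine (card_le_card fun x hx => ?_).trans (card_union_le _ _)
    have := (mem_repeatsFinset.1 (mem_sigma.1 hx).2).mem_halvings
    simp only [Finset.mem_union, Finset.mem_filter]
    tauto
  rw [← card_sigma]
  change #T ≤ _
  omega

/-! ### Reading off LZ77 phrases from the lists. -/

theorem mem_earlierOcc_substr {u v : ℕ} (hi : 1 ≤ i) (h : u + m ≤ l + 1) :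
    v ∈ earlierOcc (substr s i l) u m ↔
      1 ≤ v ∧ v < u ∧ substr s (i + v - 1) m = substr s (i + u - 1) m := by
  simp only [earlierOcc, Set.mem_ofPred_eq]
  refine and_congr_right fun h1 => and_congr_right fun h2 => ?_
  rw [substr_substr hi h1 (by omega), substr_substr hi (by omega) h]

/-- An earlier occurrence in a substring is the beginning of an occurrence of a listed repeat. -/
theorem exists_repeat_of_mem_earlierOcc {u v : ℕ} (hi : 1 ≤ i) (hil : i + l ≤ s.length + 1)
    (hm : 1 ≤ m) (h : u + m ≤ l + 1) (hv : v ∈ earlierOcc (substr s i l) u m) :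
    ∃ x ∈ repeatsInto s (i + u - 1), i + v - 1 ≤ x.1 ∧ m ≤ x.2 := by
  obtain ⟨h1, h2, h3⟩ := (mem_earlierOcc_substr hi h).1 hv
  obtain ⟨q, t, hr, h4, h5⟩ := exists_isRightClosedRepeat (by omega) hm (by omega) (by omega) h3
  exact ⟨(q, t), hr, h4, h5⟩

theorem mem_earlierOcc_of_repeat {u : ℕ} {x : ℕ × ℕ} (hi : 1 ≤ i) (h : u + m ≤ l + 1)
    (hx : x ∈ repeatsInto s (i + u - 1)) (hix : i ≤ x.1) (hm : m ≤ x.2) :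
    x.1 - i + 1 ∈ earlierOcc (substr s i l) u m := by
  obtain ⟨h1, h2, h3, h4, h5, -, -⟩ := hx
  rw [mem_earlierOcc_substr hi h]
  refine ⟨by omega, by omega, ?_⟩
  rw [show i + (x.1 - i + 1) - 1 = x.1 by omega]
  exact (substr_eq_of_le h5 hm).symm

theorem phrase_of_no_repeat {u : ℕ} (hi : 1 ≤ i) (hil : i + l ≤ s.length + 1) (hu : u ≤ l)
    (h : ∀ x ∈ repeatsInto s (i + u - 1), x.1 < i) :
    IsLZ77Phrase (substr s i l) u 1 ∧ IsRightmostSource (substr s i l) u 1 none := by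
  have he : earlierOcc (substr s i l) u 1 = ∅ := by
    rw [Set.eq_empty_iff_forall_notMem]
    intro v hv
    have h1 := hv.1
    obtain ⟨x, hx, h2, -⟩ := exists_repeat_of_mem_earlierOcc hi hil le_rfl (by omega) hv
    have := h x hx
    omega
  exact ⟨.inl ⟨rfl, by rwa [length_substr hi hil], he⟩, he⟩

/-- An earlier occurrence inside the window yields a listed pair at least as long with `q ≥ i`, so
maximality of `x` bounds the phrase. No later source exists since `p` is the next occurrence after
`x.1`. -/
theorem phrase_of_repeat {u : ℕ} {x : ℕ × ℕ} (hi : 1 ≤ i)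
    (hil : i + l ≤ s.length + 1) (hx : x ∈ repeatsInto s (i + u - 1)) (hix : i ≤ x.1)
    (hmax : ∀ y ∈ repeatsInto s (i + u - 1), i ≤ y.1 → y.2 ≤ x.2) (hxl : u + x.2 ≤ l + 1) :
    IsLZ77Phrase (substr s i l) u x.2 ∧
      IsRightmostSource (substr s i l) u x.2 (some (x.1 - i + 1)) := by
  have hocc := mem_earlierOcc_of_repeat hi hxl hx hix le_rfl
  have ht := hx.2.1
  refine ⟨.inr ⟨⟨ht, by rwa [length_substr hi hil], _, hocc⟩, ?_⟩, hocc, ?_⟩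
  · rintro k ⟨hk, hk', v, hv⟩
    have h1 := hv.1
    rw [length_substr hi hil] at hk'
    obtain ⟨y, hy, h2, h3⟩ := exists_repeat_of_mem_earlierOcc hi hil hk hk' hv
    exact h3.trans (hmax y hy (by omega))
  · intro v hv
    obtain ⟨h1, h2, h3⟩ := (mem_earlierOcc_substr hi hxl).1 hv
    obtain ⟨-, -, -, -, h5, h6, -⟩ := hx
    by_contra! hlt
    exact h6 (i + v - 1) (by omega) (by omega) (h3.trans h5)

/-- The pair `x` shows that the whole rest has a source in the window. Among the pairs covering the
rest, the shortest, `y`, has the greatest position by the staircase property, so it gives the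
rightmost source. -/
theorem phrase_of_long_repeat {u : ℕ} {x y : ℕ × ℕ} (hi : 1 ≤ i)
    (hil : i + l ≤ s.length + 1) (hu : u ≤ l)
    (hx : x ∈ repeatsInto s (i + u - 1)) (hix : i ≤ x.1) (hxl : l + 1 - u ≤ x.2)
    (hy : y ∈ repeatsInto s (i + u - 1)) (hyl : l + 1 - u ≤ y.2)
    (hmin : ∀ z ∈ repeatsInto s (i + u - 1), l + 1 - u ≤ z.2 → y.2 ≤ z.2) :
    IsLZ77Phrase (substr s i l) u (l + 1 - u) ∧
      IsRightmostSource (substr s i l) u (l + 1 - u) (some (y.1 - i + 1)) := by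
  have hle : ∀ z ∈ repeatsInto s (i + u - 1), l + 1 - u ≤ z.2 → z.1 ≤ y.1 := by
    intro z hz hzl
    rcases (hmin z hz hzl).eq_or_lt with h | h
    · refine (IsRightClosedRepeat.left_unique (t := z.2) hz ?_).le
      rw [← h]
      exact hy
    · exact (IsRightClosedRepeat.lt_of_lt hy hz h).le
  have hocc := mem_earlierOcc_of_repeat (u := u) (l := l) (m := l + 1 - u) hi (by omega) hy
    (hix.trans (hle x hx hxl)) hyl
  refine ⟨.inr ⟨⟨by omega, by rw [length_substr hi hil]; omega, _, hocc⟩, ?_⟩, hocc, ?_⟩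
  · rintro k ⟨-, hk', -⟩
    rw [length_substr hi hil] at hk'
    omega
  · intro v hv
    obtain ⟨z, hz, h1, h2⟩ := exists_repeat_of_mem_earlierOcc hi hil (by omega) (by omega) hv
    have := hle z hz h2
    have := hv.1
    omega

end Strings
/-! ## A small language on top of the word RAM

Registers from `50` on are scratch registers for the evaluation of expressions. -/

/-- Expressions over registers, literals and memory cells. -/
inductive Expr
  | reg (r : ℕ)
  | lit (c : ℕ)
  | bin (o : BinOp) (a b : Expr)
  | ld (a : Expr)

instance : Add Expr := ⟨.bin .add⟩
instance : Sub Expr := ⟨.bin .sub⟩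
instance : Mul Expr := ⟨.bin .mul⟩
instance : Div Expr := ⟨.bin .div⟩
instance : Mod Expr := ⟨.bin .mod⟩

/-- The program that evaluates an expression into register `d`, using the registers from `d` on. -/
def Expr.comp : Expr → ℕ → Prog
  | .reg r, d => .move d r
  | .lit c, d => .const d c
  | .bin o a b, d => .seq (a.comp d) (.seq (b.comp (d + 1)) (.op o d d (d + 1)))
  | .ld a, d => .seq (a.comp d) (.load d d)

/-- The time for the evaluation of an expression. -/
def Expr.cost : Expr → ℕ
  | .reg _ => 1
  | .lit _ => 1
  | .bin _ a b => a.cost + (b.cost + 1)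
  | .ld a => a.cost + 1

/-- `e.Val w mem V v`: the expression has value `v` if the registers have the values `V`. -/
def Expr.Val (w : ℕ) (mem : List ℕ) (V : ℕ → ℕ) : Expr → ℕ → Prop
  | .reg r, v => r < 50 ∧ V r = v
  | .lit c, v => c % 2 ^ w = v
  | .bin o a b, v => ∃ x y, a.Val w mem V x ∧ b.Val w mem V y ∧ o.eval w x y = v
  | .ld a, v => ∃ x, a.Val w mem V x ∧ mem[x]? = some v

section Language
variable {w : ℕ} {mem : List ℕ} {V : ℕ → ℕ} {o : List ℕ}

/-- Stack discipline: evaluation into `d` leaves the registers below `d` alone, so a left operand in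
`d` survives the evaluation of the right one into `d + 1`. -/
theorem Expr.comp_exec {e : Expr} {v : ℕ} (h : e.Val w mem V v) (d : ℕ) (hd : 50 ≤ d)
    (ρ : ℕ → ℕ) (hρ : ∀ r < 50, ρ r = V r) :
    ∃ ρ', Exec w (e.comp d) ⟨ρ, mem, o⟩ e.cost ⟨ρ', mem, o⟩ ∧ (∀ r < d, ρ' r = ρ r) ∧ ρ' d = v := by
  induction e generalizing v d ρ with
  | reg r =>
    obtain ⟨hr, rfl⟩ := h
    exact ⟨_, .move _ _ _, fun r' hr' => by simp [hr'.ne], by simp [hρ r hr]⟩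
  | lit c =>
    obtain rfl := h
    exact ⟨_, .const _ _ _, fun r hr => by simp [hr.ne], by simp⟩
  | bin p a b iha ihb =>
    obtain ⟨x, y, ha, hb, rfl⟩ := h
    obtain ⟨ρ₁, h₁, f₁, v₁⟩ := iha ha d hd ρ hρ
    obtain ⟨ρ₂, h₂, f₂, v₂⟩ := ihb hb (d + 1) (by omega) ρ₁
      fun r hr => (f₁ r (by omega)).trans (hρ r hr)
    refine ⟨_, .seq h₁ (.seq h₂ (.op _ _ _ _ _)), fun r hr => ?_, ?_⟩
    · simp [hr.ne, f₂ r (by omega), f₁ r hr]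
    · simp [f₂ d (by omega), v₁, v₂]
  | ld a iha =>
    obtain ⟨x, ha, hx⟩ := h
    obtain ⟨ρ₁, h₁, f₁, v₁⟩ := iha ha d hd ρ hρ
    refine ⟨_, .seq h₁ (.load _ _ _ v (by simpa [v₁] using hx)), fun r hr => ?_, ?_⟩
    · simp [hr.ne, f₁ r hr]
    · simp

/-- `WP w mem P T Q V o`: if the first `50` registers have the values `V` and the output is `o`,
then `P` halts within time `T` and without changing the memory, with register values and an output
that satisfy `Q`. -/
def WP (w : ℕ) (mem : List ℕ) (P : Prog) (T : ℕ) (Q : (ℕ → ℕ) → List ℕ → Prop) (V : ℕ → ℕ)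
    (o : List ℕ) : Prop :=
  ∃ V' o', Q V' o' ∧ ∀ ρ : ℕ → ℕ, (∀ r < 50, ρ r = V r) →
    ∃ k ≤ T, ∃ ρ' : ℕ → ℕ, (∀ r < 50, ρ' r = V' r) ∧ Exec w P ⟨ρ, mem, o⟩ k ⟨ρ', mem, o'⟩

variable {P P' : Prog} {T T' : ℕ} {Q Q' : (ℕ → ℕ) → List ℕ → Prop} {e : Expr} {v : ℕ}

theorem WP.mono (h : WP w mem P T Q V o) (hT : T ≤ T') (hQ : ∀ V' o', Q V' o' → Q' V' o') :
    WP w mem P T' Q' V o := by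
  obtain ⟨V', o', h1, h2⟩ := h
  refine ⟨V', o', hQ _ _ h1, fun ρ hρ => ?_⟩
  obtain ⟨k, hk, h3⟩ := h2 ρ hρ
  exact ⟨k, hk.trans hT, h3⟩

theorem WP.seq (h : WP w mem P T (WP w mem P' T' Q) V o) : WP w mem (.seq P P') (T + T') Q V o := by
  obtain ⟨V₁, o₁, ⟨V₂, o₂, hQ, h₂⟩, h₁⟩ := h
  refine ⟨V₂, o₂, hQ, fun ρ hρ => ?_⟩
  obtain ⟨k, hk, ρ₁, hρ₁, e₁⟩ := h₁ ρ hρ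
  obtain ⟨l, hl, ρ₂, hρ₂, e₂⟩ := h₂ ρ₁ hρ₁
  exact ⟨k + l, by omega, ρ₂, hρ₂, .seq e₁ e₂⟩

theorem WP.skip (h : Q V o) : WP w mem .skip 1 Q V o :=
  ⟨V, o, h, fun ρ hρ => ⟨1, le_rfl, ρ, hρ, .skip _⟩⟩

/-- Assignment of the value of an expression. -/
def assign (r : ℕ) (e : Expr) : Prog := .seq (e.comp 50) (.move r 50)

theorem WP.assign {r : ℕ} (he : e.Val w mem V v) (h : Q (Function.update V r v) o) :
    WP w mem (assign r e) (e.cost + 1) Q V o := by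
  refine ⟨_, _, h, fun ρ hρ => ?_⟩
  obtain ⟨ρ₁, h₁, f₁, v₁⟩ := e.comp_exec he 50 le_rfl ρ hρ (o := o)
  refine ⟨_, le_rfl, _, fun r' hr' => ?_, .seq h₁ (.move _ _ _)⟩
  simp [Function.update_apply, v₁, f₁ r' hr', hρ r' hr']

/-- Output of the value of an expression. -/
def output (e : Expr) : Prog := .seq (e.comp 50) (.emit 50)

theorem WP.output (he : e.Val w mem V v) (h : Q V (o ++ [v])) :
    WP w mem (output e) (e.cost + 1) Q V o := by
  refine ⟨_, _, h, fun ρ hρ => ?_⟩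
  obtain ⟨ρ₁, h₁, f₁, v₁⟩ := e.comp_exec he 50 le_rfl ρ hρ (o := o)
  have h₂ := Exec.emit (w := w) ⟨ρ₁, mem, o⟩ 50
  dsimp only at h₂; rw [v₁] at h₂
  exact ⟨_, le_rfl, ρ₁, fun r hr => (f₁ r hr).trans (hρ r hr), .seq h₁ h₂⟩

/-- Case distinction on the value of an expression. -/
def branch (e : Expr) (P P' : Prog) : Prog := .seq (e.comp 50) (.cond 50 P P')

theorem WP.branch (he : e.Val w mem V v) (h : v ≠ 0 → WP w mem P T Q V o)
    (h' : v = 0 → WP w mem P' T Q V o) : WP w mem (branch e P P') (e.cost + (T + 1)) Q V o := by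
  by_cases hv : v = 0
  · obtain ⟨V', o', hQ, h₂⟩ := h' hv
    refine ⟨V', o', hQ, fun ρ hρ => ?_⟩
    obtain ⟨ρ₁, h₁, f₁, v₁⟩ := e.comp_exec he 50 le_rfl ρ hρ (o := o)
    obtain ⟨k, hk, ρ₂, hρ₂, e₂⟩ := h₂ ρ₁ fun r hr => (f₁ r hr).trans (hρ r hr)
    exact ⟨_, by omega, ρ₂, hρ₂, .seq h₁ (.cond_false (v₁.trans hv) e₂)⟩
  · obtain ⟨V', o', hQ, h₂⟩ := h hv
    refine ⟨V', o', hQ, fun ρ hρ => ?_⟩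
    obtain ⟨ρ₁, h₁, f₁, v₁⟩ := e.comp_exec he 50 le_rfl ρ hρ (o := o)
    obtain ⟨k, hk, ρ₂, hρ₂, e₂⟩ := h₂ ρ₁ fun r hr => (f₁ r hr).trans (hρ r hr)
    exact ⟨_, by omega, ρ₂, hρ₂, .seq h₁ (.cond_true (fun h => hv (v₁.symm.trans h)) e₂)⟩

/-- Repetition as long as the value of an expression is not zero. -/
def loopWhile (e : Expr) (P : Prog) : Prog := .seq (e.comp 50) (.loop 50 (.seq P (e.comp 50)))

theorem WP.while_done (he : e.Val w mem V 0) (h : Q V o) :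
    WP w mem (loopWhile e P) (e.cost + 1) Q V o := by
  refine ⟨_, _, h, fun ρ hρ => ?_⟩
  obtain ⟨ρ₁, h₁, f₁, v₁⟩ := e.comp_exec he 50 le_rfl ρ hρ (o := o)
  exact ⟨_, le_rfl, ρ₁, fun r hr => (f₁ r hr).trans (hρ r hr), .seq h₁ (.loop_done v₁)⟩

theorem WP.while_step (he : e.Val w mem V v) (hv : v ≠ 0)
    (h : WP w mem P T (WP w mem (loopWhile e P) T' Q) V o) :
    WP w mem (loopWhile e P) (e.cost + 1 + T + T') Q V o := by
  obtain ⟨V₁, o₁, ⟨V₂, o₂, hQ, h₂⟩, h₁⟩ := h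
  refine ⟨V₂, o₂, hQ, fun ρ hρ => ?_⟩
  obtain ⟨ρ', e₀, f₀, v₀⟩ := e.comp_exec he 50 le_rfl ρ hρ (o := o)
  obtain ⟨k, hk, ρ₁, hρ₁, e₁⟩ := h₁ ρ' fun r hr => (f₀ r hr).trans (hρ r hr)
  obtain ⟨l, hl, ρ₂, hρ₂, e₂⟩ := h₂ ρ₁ hρ₁
  -- The guard is re-evaluated at the end of the body; that evaluation is the initial one of the
  -- remaining `loopWhile`.
  cases e₂ with
  | @seq _ _ _ τ _ c m hc hloop =>
    refine ⟨_, ?_, ρ₂, hρ₂, .seq e₀ (.loop_step (fun h => hv (v₀.symm.trans h)) (.seq e₁ hc) hloop)⟩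
    omega

/-- A loop with a variant `μ`. -/
theorem WP.while_of_variant (I : ℕ → (ℕ → ℕ) → List ℕ → Prop)
    (hI : ∀ μ V o, I μ V o → ∃ v, e.Val w mem V v ∧ (v = 0 → Q V o) ∧
      (v ≠ 0 → WP w mem P T (fun V' o' => ∃ μ' < μ, I μ' V' o') V o)) {μ : ℕ} (h : I μ V o) :
    WP w mem (loopWhile e P) ((e.cost + 1 + T) * μ + (e.cost + 1)) Q V o := by
  induction μ using Nat.strong_induction_on generalizing V o with
  | _ μ ih =>
    obtain ⟨v, he, h0, h1⟩ := hI μ V o h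
    by_cases hv : v = 0
    · subst hv
      exact (WP.while_done he (h0 rfl)).mono (by omega) fun _ _ h => h
    · obtain ⟨V', o', ⟨μ', hμ, h2⟩, h3⟩ := h1 hv
      have h4 : WP w mem P T (WP w mem (loopWhile e P) ((e.cost + 1 + T) * μ' + (e.cost + 1)) Q) V o :=
        ⟨V', o', ih μ' hμ h2, h3⟩
      refine (WP.while_step he hv h4).mono ?_ fun _ _ h => h
      have : (e.cost + 1 + T) * (μ' + 1) ≤ (e.cost + 1 + T) * μ := Nat.mul_le_mul_left _ hμ
      linarith

namespace Expr.Val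
variable {a b : Expr} {x y r c : ℕ}

theorem reg (h : V r = x) (hr : r < 50 := by decide) : (Expr.reg r).Val w mem V x := ⟨hr, h⟩

theorem lit (hc : c < 2 ^ w) : (Expr.lit c).Val w mem V c := Nat.mod_eq_of_lt hc

theorem add (ha : a.Val w mem V x) (hb : b.Val w mem V y) (h : x + y < 2 ^ w) :
    (a + b).Val w mem V (x + y) := ⟨x, y, ha, hb, Nat.mod_eq_of_lt h⟩

theorem sub (ha : a.Val w mem V x) (hb : b.Val w mem V y) (h : y ≤ x) (hx : x < 2 ^ w) :
    (a - b).Val w mem V (x - y) := by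
  refine ⟨x, y, ha, hb, ?_⟩
  rw [BinOp.eval, show x + 2 ^ w - y = (x - y) + 2 ^ w by omega, Nat.add_mod_right,
    Nat.mod_eq_of_lt (by omega)]

theorem mul (ha : a.Val w mem V x) (hb : b.Val w mem V y) (h : x * y < 2 ^ w) :
    (a * b).Val w mem V (x * y) := ⟨x, y, ha, hb, Nat.mod_eq_of_lt h⟩

theorem div (ha : a.Val w mem V x) (hb : b.Val w mem V y) : (a / b).Val w mem V (x / y) :=
  ⟨x, y, ha, hb, rfl⟩

theorem mod (ha : a.Val w mem V x) (hb : b.Val w mem V y) : (a % b).Val w mem V (x % y) :=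
  ⟨x, y, ha, hb, rfl⟩

theorem shr (ha : a.Val w mem V x) (hb : b.Val w mem V y) :
    (Expr.bin .shr a b).Val w mem V (x / 2 ^ y) := ⟨x, y, ha, hb, rfl⟩

theorem lt (ha : a.Val w mem V x) (hb : b.Val w mem V y) :
    (Expr.bin .lt a b).Val w mem V (if x < y then 1 else 0) := ⟨x, y, ha, hb, rfl⟩

theorem eq (ha : a.Val w mem V x) (hb : b.Val w mem V y) :
    (Expr.bin .eq a b).Val w mem V (if x = y then 1 else 0) := ⟨x, y, ha, hb, rfl⟩

theorem ld (ha : a.Val w mem V x) (h : mem[x]? = some y) : (Expr.ld a).Val w mem V y := ⟨x, ha, h⟩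

theorem congr (ha : a.Val w mem V x) (h : x = y) : a.Val w mem V y := h ▸ ha

end Expr.Val

theorem WP.answers {T : ℕ} {out : List ℕ} {x y : ℕ} {B : ℝ}
    (h : WP w mem P T (fun _ o => o = out) (fun r => if r = 0 then x else if r = 1 then y else 0) [])
    (hB : (T : ℝ) ≤ B) : Answers w P mem x y out B := by
  obtain ⟨V', o', rfl, h⟩ := h
  obtain ⟨k, hk, ρ', -, he⟩ := h _ fun _ _ => rfl
  exact ⟨k, _, he, rfl, rfl, le_trans (by exact_mod_cast hk) hB⟩

end Language
/-! ## Perfect hashing -/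

/-- Multiplicative hashing modulo a prime. -/
def hash (P m a x : ℕ) : ℕ := a * x % P % m

section Hashing
variable {P m : ℕ} {S : Finset ℕ}

/-- The difference `δ a` of the residues modulo `P` is congruent to `a (x - y)`, hence non-zero and
injective in `a`. A collision means `m ∣ δ a`, and `|δ a| ≤ P - 1`; the quotients `δ a / m` are
distinct non-zero integers of absolute value at most `(P - 1) / m`. -/
theorem mul_card_collisions_le (hP : P.Prime) (hm : 0 < m) {x y : ℕ} (hx : x < P) (hy : y < P)
    (hxy : x ≠ y) : m * #{a ∈ Ioo 0 P | hash P m a x = hash P m a y} ≤ 2 * (P - 1) := by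
  set K : ℕ := (P - 1) / m with hK
  have hm' : (0 : ℤ) < m := by exact_mod_cast hm
  let δ : ℕ → ℤ := fun a => (a * x % P : ℕ) - (a * y % P : ℕ)
  have hmod : ∀ a, δ a ≡ a * (x - y) [ZMOD P] := by
    intro a
    have h1 : ((a * x % P : ℕ) : ℤ) ≡ (a * x : ℤ) [ZMOD P] := by
      push_cast; exact Int.mod_modEq _ _
    have h2 : ((a * y % P : ℕ) : ℤ) ≡ (a * y : ℤ) [ZMOD P] := by
      push_cast; exact Int.mod_modEq _ _
    rw [mul_sub]
    exact h1.sub h2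
  have hP' : Prime (P : ℤ) := Nat.prime_iff_prime_int.1 hP
  have hxyP : ¬ (P : ℤ) ∣ (x : ℤ) - y := by
    intro h
    have := Int.eq_zero_of_abs_lt_dvd h (by rw [abs_lt]; omega)
    omega
  have hinj : ∀ a ∈ Ioo 0 P, ∀ b ∈ Ioo 0 P, δ a = δ b → a = b := by
    intro a ha b hb h
    rw [mem_Ioo] at ha hb
    have h1 : (a * (x - y) : ℤ) ≡ b * (x - y) [ZMOD P] := (hmod a).symm.trans (h ▸ hmod b)
    have h2 := h1.symm.dvd
    rw [← sub_mul] at h2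
    rcases hP'.dvd_or_dvd h2 with h3 | h3
    · have := Int.eq_zero_of_abs_lt_dvd h3 (by rw [abs_lt]; omega)
      omega
    · exact absurd h3 hxyP
  have hne : ∀ a ∈ Ioo 0 P, δ a ≠ 0 := by
    intro a ha h
    rw [mem_Ioo] at ha
    have h1 := (hmod a).symm.dvd
    rw [h, zero_sub, dvd_neg] at h1
    rcases hP'.dvd_or_dvd h1 with h3 | h3
    · have := Int.eq_zero_of_abs_lt_dvd h3 (by rw [abs_lt]; omega)
      omega
    · exact absurd h3 hxyP
  have hcard : #{a ∈ Ioo 0 P | hash P m a x = hash P m a y} ≤ #((Icc (-K : ℤ) K).erase 0) := by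
    have hdvd : ∀ a, hash P m a x = hash P m a y → (m : ℤ) ∣ δ a := by
      intro a h
      exact Nat.modEq_iff_dvd.1 h.symm
    refine card_le_card_of_injOn (fun a => δ a / m) ?_ ?_
    · intro a ha
      simp only [coe_filter, Set.mem_ofPred_eq] at ha
      obtain ⟨c, hc⟩ := hdvd a ha.2
      have h0 := hne a ha.1
      have h1 : a * x % P < P := Nat.mod_lt _ hP.pos
      have h2 : a * y % P < P := Nat.mod_lt _ hP.pos
      have h3 : |δ a| ≤ (P - 1 : ℕ) := by
        simp only [δ]; rw [abs_le]; omega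
      have h4 : |c| ≤ K := by
        rw [hc, abs_mul, Nat.abs_cast] at h3
        rw [hK, Int.natCast_div]
        exact (Int.le_ediv_iff_mul_le hm').2 (by linarith)
      simp only [hc, Int.mul_ediv_cancel_left _ hm'.ne', coe_erase, coe_Icc, Set.mem_sdiff,
        Set.mem_Icc, Set.mem_singleton_iff]
      refine ⟨abs_le.1 h4, fun h => h0 ?_⟩
      rw [hc, h, mul_zero]
    · intro a ha b hb h
      simp only [coe_filter, Set.mem_ofPred_eq] at ha hb
      refine hinj a ha.1 b hb.1 ?_
      rw [← Int.mul_ediv_cancel' (hdvd a ha.2), ← Int.mul_ediv_cancel' (hdvd b hb.2)]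
      exact congrArg _ h
  have hK2 : #((Icc (-K : ℤ) K).erase 0) = 2 * K := by
    rw [card_erase_of_mem (by simp), Int.card_Icc]
    omega
  rw [hK2] at hcard
  calc _ ≤ m * (2 * K) := Nat.mul_le_mul_left _ hcard
    _ = 2 * (m * K) := by ring
    _ ≤ _ := Nat.mul_le_mul_left _ (Nat.mul_div_le _ _)

theorem exists_few_collisions (hP : P.Prime) (hm : 0 < m) (hS : ∀ x ∈ S, x < P) :
    ∃ a < P, m * #{x ∈ S.offDiag | hash P m a x.1 = hash P m a x.2} ≤ 2 * #S.offDiag := by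
  have h : ∑ a ∈ Ioo 0 P, m * #{x ∈ S.offDiag | hash P m a x.1 = hash P m a x.2} ≤
      ∑ _a ∈ Ioo 0 P, 2 * #S.offDiag := by
    calc _ = ∑ x ∈ S.offDiag, m * #{a ∈ Ioo 0 P | hash P m a x.1 = hash P m a x.2} := by
          simp only [← mul_sum, card_filter]
          rw [sum_comm]
      _ ≤ ∑ x ∈ S.offDiag, 2 * (P - 1) := by
          refine sum_le_sum fun x hx => ?_
          rw [mem_offDiag] at hx
          exact mul_card_collisions_le hP hm (hS _ hx.1) (hS _ hx.2.1) hx.2.2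
      _ = _ := by
          simp only [sum_const, Nat.card_Ioo, smul_eq_mul, Nat.sub_zero]
          ring
  have hne : (Ioo 0 P).Nonempty := ⟨1, by simp [hP.one_lt]⟩
  obtain ⟨a, ha, h'⟩ := exists_le_of_sum_le hne h
  exact ⟨a, (mem_Ioo.1 ha).2, h'⟩

/-- The position that a two-level hash table with the first-level parameters `m` and `a`, and the
second-level parameters `off`, `sz` and `mul` gives to a key. -/
def hashPos (P m a : ℕ) (off sz mul : ℕ → ℕ) (x : ℕ) : ℕ :=
  off (hash P m a x) + hash P (sz (hash P m a x)) (mul (hash P m a x)) x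

/-- The scheme of Fredman, Komlós and Szemerédi: the first level leaves at most `2 * #S` colliding
ordered pairs, so the squared bucket sizes sum to at most `3 * #S`. A bucket of `b` keys receives `2
* b ^ 2 + 1` cells, enough for no collision at all, and the total is at most `6 * #S + #S + 1`. The
position bound covers every `x`, so that unsuccessful look-ups also stay inside the table. -/
theorem exists_perfect_hash (hP : P.Prime) (hS : ∀ x ∈ S, x < P) :
    ∃ (a : ℕ) (off sz mul : ℕ → ℕ) (T : ℕ), a < P ∧ T ≤ 7 * #S + 1 ∧
      (∀ h < #S + 1, off h < T ∧ sz h ≤ T ∧ mul h < P) ∧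
      (∀ x, hashPos P (#S + 1) a off sz mul x < T) ∧
      Set.InjOn (hashPos P (#S + 1) a off sz mul) S := by
  set m := #S + 1 with hm
  obtain ⟨a, haP, ha⟩ := exists_few_collisions (m := m) hP (by omega) hS
  let B : ℕ → Finset ℕ := fun h => {x ∈ S | hash P m a x = h}
  have hB : ∀ h, ∃ b < P, Set.InjOn (hash P (2 * #(B h) ^ 2 + 1) b) (B h) := by
    intro h
    obtain ⟨b, hbP, hb⟩ := exists_few_collisions (S := B h) (m := 2 * #(B h) ^ 2 + 1) hP (by omega)
      fun x hx => hS x (mem_filter.1 hx).1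
    refine ⟨b, hbP, fun x hx y hy hxy => ?_⟩
    by_contra hne
    -- A single collision would give `2 b² + 1 ≤ 2 (b² - b)`, where `b` is the bucket size.
    have h1 : 0 < #{x ∈ (B h).offDiag | hash P (2 * #(B h) ^ 2 + 1) b x.1 =
        hash P (2 * #(B h) ^ 2 + 1) b x.2} :=
      card_pos.2 ⟨(x, y), by simpa [hne, hxy] using ⟨hx, hy⟩⟩
    have h2 := Nat.le_mul_of_pos_right (2 * #(B h) ^ 2 + 1) h1
    rw [offDiag_card] at hb
    have h3 : #(B h) * #(B h) = #(B h) ^ 2 := by ring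
    omega
  choose mul hmulP hmul using hB
  let sz : ℕ → ℕ := fun h => 2 * #(B h) ^ 2 + 1
  let off : ℕ → ℕ := fun h => ∑ i ∈ range h, sz i
  have hoff : ∀ h, off (h + 1) = off h + sz h := fun h => sum_range_succ _ _
  have hmono : Monotone off := monotone_nat_of_le_succ fun h => by rw [hoff]; omega
  have hpos : ∀ x, off (hash P m a x) ≤ hashPos P m a off sz mul x ∧
      hashPos P m a off sz mul x < off (hash P m a x + 1) := by
    intro x
    have : hash P (sz (hash P m a x)) (mul (hash P m a x)) x < sz (hash P m a x) :=
      Nat.mod_lt _ (by simp [sz])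
    rw [hoff]
    unfold hashPos
    omega
  have hlt : ∀ x, hash P m a x < m := fun x => Nat.mod_lt _ (by omega)
  refine ⟨a, off, sz, mul, off m, haP, ?_, fun h hh => ?_, fun x => ?_, ?_⟩
  · have h1 : ∑ h ∈ range m, #(B h) = #S :=
      (card_eq_sum_card_fiberwise fun x _ => by simpa using hlt x).symm
    -- Squares count ordered pairs within a bucket: the diagonal plus the colliding pairs.
    have h2 : ∑ h ∈ range m, #(B h) ^ 2 = #S + #{x ∈ S.offDiag | hash P m a x.1 = hash P m a x.2} := by
      rw [card_eq_sum_card_fiberwise (f := fun x : ℕ × ℕ => hash P m a x.1) (t := range m)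
        fun x _ => by simpa using hlt x.1, ← h1, ← sum_add_distrib]
      refine sum_congr rfl fun h _ => ?_
      have : {x ∈ {x ∈ S.offDiag | hash P m a x.1 = hash P m a x.2} | hash P m a x.1 = h} =
          (B h).offDiag := by
        ext ⟨x, y⟩
        simp only [B, Finset.mem_filter, mem_offDiag]
        constructor
        · rintro ⟨⟨⟨h1, h2, h3⟩, h4⟩, h5⟩
          exact ⟨⟨h1, h5⟩, ⟨h2, h4 ▸ h5⟩, h3⟩
        · rintro ⟨⟨h1, h5⟩, ⟨h2, h6⟩, h3⟩
          exact ⟨⟨⟨h1, h2, h3⟩, h5.trans h6.symm⟩, h5⟩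
      rw [this, offDiag_card, sq]
      have := Nat.le_mul_self #(B h)
      omega
    have h3 : #{x ∈ S.offDiag | hash P m a x.1 = hash P m a x.2} ≤ 2 * #S := by
      rw [offDiag_card] at ha
      by_contra! hc
      have h4 := Nat.mul_le_mul_left m hc.le
      have h5 : m * (2 * #S) = 2 * (#S * #S) + 2 * #S := by rw [hm]; ring
      have h6 : 0 < #S * #S ∨ #S = 0 := by
        rcases Nat.eq_zero_or_pos #S with h | h
        · exact .inr h
        · exact .inl (Nat.mul_pos h h)
      rcases h6 with h6 | h6
      · rcases Nat.eq_zero_or_pos #S with h7 | h7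
        · simp [h7] at h6
        · omega
      · have : S = ∅ := card_eq_zero.1 h6
        simp [this] at hc
    simp only [off, sz, sum_add_distrib, ← mul_sum, h2, sum_const, card_range, smul_eq_mul]
    omega
  · have h1 : off (h + 1) ≤ off m := hmono hh
    have h2 : 0 < sz h := by simp [sz]
    rw [hoff] at h1
    exact ⟨by omega, by omega, hmulP h⟩
  · exact (hpos x).2.trans_le (hmono (hlt x))
  · intro x hx y hy hxy
    rcases lt_trichotomy (hash P m a x) (hash P m a y) with h | h | h
    · have := (hpos x).2.trans_le ((hmono (Nat.succ_le_of_lt h)).trans (hpos y).1)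
      omega
    · refine hmul (hash P m a y) (by simpa [B] using ⟨hx, h⟩ : x ∈ _)
        (by simpa [B] using hy : y ∈ _) ?_
      unfold hashPos at hxy
      rw [h] at hxy
      exact Nat.add_left_cancel hxy
    · have := (hpos y).2.trans_le ((hmono (Nat.succ_le_of_lt h)).trans (hpos x).1)
      omega

end Hashing
/-! ## A rank structure for a sorted array -/

/-- The least `j` with `y < 2 ^ 2 ^ j`. -/
def level (y : ℕ) : ℕ := Nat.clog 2 (Nat.size y)

theorem level_le_iff {y j : ℕ} : level y ≤ j ↔ y < 2 ^ 2 ^ j := by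
  rw [level, Nat.clog_le_iff_le_pow (by norm_num), Nat.size_le]

theorem lt_two_pow_level (y : ℕ) : y < 2 ^ 2 ^ level y := level_le_iff.1 le_rfl

theorem level_mono {x y : ℕ} (h : x ≤ y) : level x ≤ level y :=
  level_le_iff.2 (h.trans_lt (lt_two_pow_level y))

/-- Rounding a bit length up to a power of two less than doubles it; this is why trie depths below
`2 * g` suffice. -/
theorem two_pow_level_le {y g : ℕ} (hg : 1 ≤ g) (h : y < 2 ^ g) : 2 ^ level y < 2 * g := by
  by_cases h0 : level y = 0
  · rw [h0]; omega
  · by_contra! hc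
    have h1 : 2 ^ level y = 2 ^ (level y - 1) * 2 := by
      rw [← pow_succ]; congr 1; omega
    have h2 : ¬ level y ≤ level y - 1 := by omega
    rw [level_le_iff] at h2
    exact h2 (h.trans_le (Nat.pow_le_pow_right (by norm_num) (by omega)))

/-- `r` of the keys `a 0 < ⋯ < a (k - 1)` are smaller than `y`. -/
def IsRank (a : ℕ → ℕ) (k y r : ℕ) : Prop :=
  r ≤ k ∧ (∀ x < r, a x < y) ∧ ∀ x, r ≤ x → x < k → y ≤ a x

/-- The indices of the keys that are represented in the trie. -/
def IsRep (a : ℕ → ℕ) (x : ℕ) : Prop := 2 ^ level (a x) ∣ x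

open Classical in
/-- The index of the last represented key that is smaller than `y`. -/
noncomputable def repBelow (a : ℕ → ℕ) (k y : ℕ) : ℕ :=
  ({x ∈ range k | IsRep a x ∧ a x < y}).sup id

/-- The prefix `v` that is left after the removal of `e` bits is the prefix of a represented key
or `0`. -/
def Present (a : ℕ → ℕ) (k e v : ℕ) : Prop := v = 0 ∨ ∃ x < k, IsRep a x ∧ a x / 2 ^ e = v

section Rank
variable {a : ℕ → ℕ} {k y e v : ℕ}

theorem le_repBelow {x : ℕ} (hx : x < k) (hr : IsRep a x) (h : a x < y) : x ≤ repBelow a k y := by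
  classical
  exact Finset.le_sup (f := id) (by simp [hx, hr, h])

theorem repBelow_eq_zero_or (a : ℕ → ℕ) (k y : ℕ) : repBelow a k y = 0 ∨
    repBelow a k y < k ∧ IsRep a (repBelow a k y) ∧ a (repBelow a k y) < y := by
  classical
  by_cases hs : ({x ∈ range k | IsRep a x ∧ a x < y}).Nonempty
  · right
    obtain ⟨x, hx, h⟩ := exists_mem_eq_sup _ hs id
    unfold repBelow
    rw [h]
    simpa using hx
  · left
    rw [not_nonempty_iff_eq_empty] at hs
    simp [repBelow, hs]

theorem repBelow_le (a : ℕ → ℕ) (k y : ℕ) : repBelow a k y ≤ k := by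
  rcases repBelow_eq_zero_or a k y with h | h <;> omega

theorem lt_of_lt_repBelow (ha : ∀ x x', x < x' → x' < k → a x < a x') {x : ℕ}
    (hx : x < repBelow a k y) : a x < y := by
  rcases repBelow_eq_zero_or a k y with h | ⟨h1, -, h2⟩
  · omega
  · exact (ha _ _ hx h1).trans h2

/-- The window contains a multiple `x'` of `2 ^ level y` beyond `repBelow`. If `a x < y`, then also
`a x' < y`, so the level of `a x'` is at most `level y` and `x'` is represented, contradicting the
choice of `repBelow`. -/
theorem le_of_repBelow_add_le (ha : ∀ x x', x < x' → x' < k → a x < a x') {x : ℕ}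
    (hx : repBelow a k y + 2 ^ level y ≤ x) (hk : x < k) : y ≤ a x := by
  by_contra! hc
  set b := 2 ^ level y with hb
  have hb0 : 0 < b := by positivity
  set x' := (repBelow a k y + b) / b * b with hx'
  have h1 : x' ≤ repBelow a k y + b := Nat.div_mul_le_self _ _
  have h2 : repBelow a k y < x' := by
    have := Nat.lt_div_mul_add (a := repBelow a k y + b) hb0
    omega
  have h3 : a x' ≤ a x := by
    rcases (h1.trans hx).eq_or_lt with h | h
    · rw [h]
    · exact (ha _ _ h hk).le
  have h4 : IsRep a x' :=
    (Nat.pow_dvd_pow 2 (level_mono (h3.trans hc.le))).trans (Dvd.intro_left _ rfl)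
  have := le_repBelow (k := k) (y := y) (x := x') (by omega) h4 (by omega)
  omega

theorem Present.succ (h : Present a k e (y / 2 ^ e)) : Present a k (e + 1) (y / 2 ^ (e + 1)) := by
  rw [pow_succ, ← Nat.div_div_eq_div_mul]
  rcases h with h | ⟨x, hx, hr, h⟩
  · exact .inl (by simp [h])
  · exact .inr ⟨x, hx, hr, by rw [pow_succ, ← Nat.div_div_eq_div_mul, h]⟩

/-- Monotonicity in the depth justifies binary search for the first present prefix. -/
theorem Present.mono {e' : ℕ} (h : Present a k e (y / 2 ^ e)) (he : e ≤ e') :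
    Present a k e' (y / 2 ^ e') := by
  induction e', he using Nat.le_induction with
  | base => exact h
  | succ n _ ih => exact ih.succ

/-- The value stored with a prefix in the trie. -/
noncomputable def trieVal (a : ℕ → ℕ) (k e v : ℕ) : ℕ := repBelow a k ((2 * v + 1) * 2 ^ e / 2)

theorem repBelow_congr {y' : ℕ} (h : ∀ x < k, IsRep a x → (a x < y ↔ a x < y')) :
    repBelow a k y = repBelow a k y' := by
  classical
  unfold repBelow
  congr 1
  refine filter_congr fun x hx => and_congr_right fun hr => h x (mem_range.1 hx) hr

/-- For `e > 0`, the value stored with `v` is taken at the middle of the interval of numbers with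
prefix `v`. As the prefix one bit longer is absent, no represented key lies in the half containing
`y`, and the threshold can be moved from `y` to the middle. -/
theorem trieVal_eq (h : ∀ e' < e, ¬ Present a k e' (y / 2 ^ e')) :
    trieVal a k e (y / 2 ^ e) = repBelow a k y := by
  rcases e with _ | e
  · simp only [trieVal, pow_zero, Nat.div_one, mul_one]
    congr 1
    omega
  · refine repBelow_congr fun x hx hr => ?_
    have hne : a x / 2 ^ e ≠ y / 2 ^ e := fun he => h e (Nat.lt_succ_self _) (.inr ⟨x, hx, hr, he⟩)
    set d := 2 ^ e with hd
    have hd0 : 0 < d := by positivity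
    rw [pow_succ, ← mul_assoc, Nat.mul_div_cancel _ (by norm_num), ← hd,
      ← Nat.div_lt_iff_lt_mul hd0, ← Nat.div_div_eq_div_mul]
    have h1 : a x < y ↔ a x / d < y / d := by
      constructor
      · intro hlt
        have := Nat.div_le_div_right (c := d) hlt.le
        omega
      · intro hlt
        by_contra! hc
        have := Nat.div_le_div_right (c := d) hc
        omega
    rw [h1]
    omega

open Classical in
/-- The entries of the trie. -/
noncomputable def trieEntries (a : ℕ → ℕ) (k g : ℕ) : Finset (ℕ × ℕ) :=
  (range (2 * g)).image (fun e => (e, 0)) ∪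
    ({x ∈ range k | IsRep a x}).biUnion fun x =>
      (range (2 ^ level (a x))).image fun e => (e, a x / 2 ^ e)

/-- From depth `2 ^ level (a x)` on, the prefix of `a x` is `0`, which the entries `(e, 0)` cover;
so cutting the paths there loses nothing. -/
theorem mem_trieEntries {g : ℕ} (he : e < 2 * g) :
    (e, v) ∈ trieEntries a k g ↔ Present a k e v := by
  classical
  simp only [trieEntries, Finset.mem_union, mem_image, Finset.mem_range, mem_biUnion, Finset.mem_filter,
    Prod.mk.injEq, Present]
  constructor
  · rintro (⟨_, -, -, rfl⟩ | ⟨x, ⟨hx, hr⟩, e', -, rfl, h⟩)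
    · exact .inl rfl
    · exact .inr ⟨x, hx, hr, h⟩
  · rintro (rfl | ⟨x, hx, hr, h⟩)
    · exact .inl ⟨e, he, rfl, rfl⟩
    · by_cases hl : e < 2 ^ level (a x)
      · exact .inr ⟨x, ⟨hx, hr⟩, e, hl, rfl, h⟩
      · refine .inl ⟨e, he, rfl, ?_⟩
        rw [← h, Nat.div_eq_of_lt]
        exact (lt_two_pow_level _).trans_le (Nat.pow_le_pow_right (by norm_num) (by omega))

theorem fst_lt_of_mem_trieEntries {g : ℕ} (hg : 1 ≤ g) (hag : ∀ x < k, a x < 2 ^ g) {z : ℕ × ℕ}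
    (hz : z ∈ trieEntries a k g) : z.1 < 2 * g ∧ z.2 < 2 ^ g := by
  classical
  simp only [trieEntries, Finset.mem_union, mem_image, Finset.mem_range, mem_biUnion,
    Finset.mem_filter] at hz
  rcases hz with ⟨e, he, rfl⟩ | ⟨x, ⟨hx, -⟩, e, he, rfl⟩
  · exact ⟨he, by positivity⟩
  · exact ⟨he.trans (two_pow_level_le hg (hag x hx)), (Nat.div_le_self _ _).trans_lt (hag x hx)⟩

open Classical in
-- Levels are monotone along the array. Each represented index of level `j` except the last starts a
-- block of `2 ^ j` indices of that level, and these blocks are disjoint; the last one accounts for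
-- the extra `2 ^ j`.
theorem card_reps_mul_le (ha : ∀ x x', x < x' → x' < k → a x < a x') (j : ℕ) :
    #{x ∈ range k | IsRep a x ∧ level (a x) = j} * 2 ^ j ≤
      #{x ∈ range k | level (a x) = j} + 2 ^ j := by
  set X := {x ∈ range k | IsRep a x ∧ level (a x) = j} with hX
  rcases X.eq_empty_or_nonempty with h | h
  · simp [h]
  · set m := X.max' h
    have hm : m ∈ X := X.max'_mem h
    have hcard : #X = #(X.erase m) + 1 := (card_erase_add_one hm).symm
    have hle : #(X.erase m ×ˢ range (2 ^ j)) ≤ #{x ∈ range k | level (a x) = j} := by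
      have hdvd : ∀ x ∈ X, 2 ^ j ∣ x := by
        intro x hx
        simp only [hX, Finset.mem_filter] at hx
        have := hx.2.1
        rwa [IsRep, hx.2.2] at this
      refine card_le_card_of_injOn (fun z => z.1 + z.2) ?_ ?_
      · rintro ⟨x, i⟩ hz
        simp only [coe_product, Set.mem_prod, Finset.mem_coe, mem_erase, Finset.mem_range] at hz
        obtain ⟨⟨hxm, hx⟩, hi⟩ := hz
        have hlt : x < m := lt_of_le_of_ne (X.le_max' x hx) hxm
        have h1 : x + 2 ^ j ≤ m := by
          have h2 := Nat.le_of_dvd (by omega) (Nat.dvd_sub (hdvd m hm) (hdvd x hx))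
          omega
        simp only [hX, Finset.mem_filter, Finset.mem_range] at hx hm
        have hle1 : level (a x) ≤ level (a (x + i)) := by
          rcases Nat.eq_zero_or_pos i with rfl | hi0
          · simp
          · exact level_mono (ha _ _ (by omega) (by omega)).le
        have hle2 : level (a (x + i)) ≤ level (a m) := level_mono (ha _ _ (by omega) (by omega)).le
        simp only [coe_filter, Set.mem_ofPred_eq, Finset.mem_range]
        omega
      · rintro ⟨x, i⟩ hz ⟨x', i'⟩ hz' h
        simp only [coe_product, Set.mem_prod, Finset.mem_coe, mem_erase, Finset.mem_range] at hz hz'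
        obtain ⟨c, rfl⟩ := hdvd x hz.1.2
        obtain ⟨c', rfl⟩ := hdvd x' hz'.1.2
        simp only at h
        have hpos : 0 < 2 ^ j := by positivity
        have h1 : (2 ^ j * c + i) / 2 ^ j = c := by
          rw [Nat.mul_add_div hpos, Nat.div_eq_of_lt hz.2, add_zero]
        have h2 : (2 ^ j * c' + i') / 2 ^ j = c' := by
          rw [Nat.mul_add_div hpos, Nat.div_eq_of_lt hz'.2, add_zero]
        rw [h, h2] at h1
        subst h1
        simp only [Prod.mk.injEq, true_and]
        omega
    rw [card_product, card_range] at hle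
    rw [hcard, add_mul, one_mul]
    omega

/-- Summing `card_reps_mul_le` over the levels gives `k` plus a geometric sum of at most `4 * g`;
the zero prefixes add `2 * g`. -/
theorem card_trieEntries_le {g : ℕ} (hg : 1 ≤ g) (ha : ∀ x x', x < x' → x' < k → a x < a x')
    (hag : ∀ x < k, a x < 2 ^ g) : #(trieEntries a k g) ≤ k + 6 * g := by
  classical
  set N := Nat.clog 2 g with hN
  have hlev : ∀ x < k, level (a x) < N + 1 := fun x hx => by
    have := Nat.clog_mono_right 2 (Nat.size_le.2 (hag x hx))
    exact Nat.lt_succ_of_le this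
  have hpow : 2 ^ (N + 1) ≤ 4 * g := by
    rcases hg.eq_or_lt with rfl | hg'
    · simp [hN]
    · have h1 : 2 ^ N.pred < g := Nat.pow_pred_clog_lt_self (by norm_num) hg'
      have h2 : N ≠ 0 := (Nat.clog_pos (by norm_num) hg').ne'
      have h3 : 2 ^ (N + 1) = 4 * 2 ^ N.pred := by
        rw [show N + 1 = N.pred + 2 by simp only [Nat.pred_eq_sub_one]; omega, pow_add]; ring
      omega
  have h1 : ∑ x ∈ range k with IsRep a x, 2 ^ level (a x) ≤ k + 4 * g := by
    calc _ = ∑ j ∈ range (N + 1), ∑ x ∈ {x ∈ range k | IsRep a x} with level (a x) = j,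
            2 ^ level (a x) := by
          refine (sum_fiberwise_of_maps_to (fun x hx => ?_) _).symm
          simp only [Finset.mem_filter, Finset.mem_range] at hx
          exact mem_range.2 (hlev x hx.1)
      _ = ∑ j ∈ range (N + 1), #{x ∈ range k | IsRep a x ∧ level (a x) = j} * 2 ^ j := by
          refine sum_congr rfl fun j _ => ?_
          rw [filter_filter, ← smul_eq_mul, ← sum_const]
          exact sum_congr rfl fun x hx => by rw [(mem_filter.1 hx).2.2]
      _ ≤ ∑ j ∈ range (N + 1), (#{x ∈ range k | level (a x) = j} + 2 ^ j) :=
          sum_le_sum fun j _ => card_reps_mul_le ha j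
      _ = #(range k) + ∑ j ∈ range (N + 1), 2 ^ j := by
          rw [sum_add_distrib, card_eq_sum_card_fiberwise (f := fun x => level (a x))
            (t := range (N + 1)) fun x hx => by simpa using hlev x (by simpa using hx)]
      _ ≤ _ := by
          rw [card_range]
          have := Nat.geomSum_lt (m := 2) (n := N + 1) (s := range (N + 1)) le_rfl fun k hk =>
            mem_range.1 hk
          omega
  calc _ ≤ _ := card_union_le _ _
    _ ≤ 2 * g + (k + 4 * g) := by
        refine Nat.add_le_add (card_image_le.trans (by simp)) (card_biUnion_le.trans ?_)
        refine le_trans (sum_le_sum fun x _ => card_image_le) ?_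
        simpa using h1
    _ = _ := by ring

end Rank

/-! ## Logarithms -/

theorem one_le_lg (x : ℝ) : 1 ≤ lg x := le_max_left _ _

theorem lg_mono {x y : ℝ} (hx : 0 < x) (h : x ≤ y) : lg x ≤ lg y :=
  max_le_max le_rfl (Real.logb_le_logb_of_le (by norm_num) hx h)

theorem lg_two_mul_le {x : ℝ} (hx : 0 < x) : lg (2 * x) ≤ 1 + lg x := by
  unfold lg
  rw [Real.logb_mul (by norm_num) hx.ne', Real.logb_self_eq_one (by norm_num)]
  refine max_le ?_ ?_
  · linarith [le_max_left 1 (Real.logb 2 x)]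
  · linarith [le_max_right 1 (Real.logb 2 x)]

/-- Needed because the position search uses the key `p - i + 1 ≤ 2 * (p - i)`. -/
theorem lg_lg_two_mul_le {x : ℝ} (hx : 0 < x) : lg (lg (2 * x)) ≤ 2 * lg (lg x) := by
  have h1 := one_le_lg x
  have h2 : lg (2 * x) ≤ 2 * lg x := by linarith [lg_two_mul_le hx]
  have h3 : lg (lg (2 * x)) ≤ lg (2 * lg x) := lg_mono (by linarith [one_le_lg (2 * x)]) h2
  linarith [lg_two_mul_le (x := lg x) (by linarith), one_le_lg (lg x)]

/-- If `level y = j > 0`, then `y ≥ 2 ^ 2 ^ (j - 1)`, so `j - 1 ≤ lg (lg y)`; the remaining `2` is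
absorbed as `lg (lg y) ≥ 1`. -/
theorem level_add_one_le (y : ℕ) : (level y + 1 : ℝ) ≤ 3 * lg (lg y) := by
  have h1 := one_le_lg (lg y)
  by_cases h0 : level y = 0
  · rw [h0]; push_cast; linarith
  · have h2 : ¬ level y ≤ level y - 1 := by omega
    rw [level_le_iff, not_lt] at h2
    have h3 : ((2 : ℝ) ^ (level y - 1)) ≤ lg y := by
      refine le_trans ?_ (le_max_right _ _)
      rw [Real.le_logb_iff_rpow_le (by norm_num)]
      · have h4 : ((2 ^ 2 ^ (level y - 1) : ℕ) : ℝ) ≤ y := by exact_mod_cast h2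
        refine le_trans (le_of_eq ?_) h4
        push_cast
        rw [← Real.rpow_natCast 2 (2 ^ (level y - 1))]
        push_cast
        rfl
      · have : 0 < y := lt_of_lt_of_le (by positivity) h2
        exact_mod_cast this
    have h4 : ((level y - 1 : ℕ) : ℝ) ≤ lg (lg y) := by
      refine le_trans ?_ (le_max_right _ _)
      rw [Real.le_logb_iff_rpow_le (by norm_num) (by linarith [one_le_lg (y : ℝ)]),
        Real.rpow_natCast]
      exact h3
    have h5 : ((level y - 1 : ℕ) : ℝ) = level y - 1 := by
      rw [Nat.cast_sub (by omega)]; simp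
    linarith

theorem natLog_add_one_le (n : ℕ) : ((Nat.log 2 n + 1 : ℕ) : ℝ) ≤ 2 * lg n := by
  have h1 := one_le_lg (n : ℝ)
  have h2 : (Nat.log 2 n : ℝ) ≤ lg n := by
    refine le_trans ?_ (le_max_right _ _)
    exact_mod_cast Real.natLog_le_logb n 2
  push_cast
  linarith

/-! ## The search programs

Register `0` and `1` hold the arguments of the query, register `2` a position, register `3` the
address of its list, register `4` the length of the list, register `5` the number of a trie,
register `6` the key to be ranked, registers `7` to `13` are auxiliary and the rank is returned in
register `8`. -/

/-- The `j`-th entry of the header, whose address is in the memory cell `0`. -/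
def header (j : ℕ) : Expr := .ld (.ld (.lit 0) + .lit j)

/-- The program that looks up the prefix of register `6` without the last `e` bits, where `e` is in
register `10`. Register `11` receives the information whether it is present, register `12` the
value. -/
def lookup : Prog :=
  .seq (assign 11 ((.reg 5 * header 0 + .reg 10) * header 0 + .bin .shr (.reg 6) (.reg 10)))
  (.seq (assign 12 (header 4 + .lit 3 * (header 2 * .reg 11 % header 1 % header 3)))
  (.seq (assign 13 (header 5 + .lit 2 * (.ld (.reg 12) +
    .ld (.reg 12 + .lit 2) * .reg 11 % header 1 % .ld (.reg 12 + .lit 1))))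
  (.seq (assign 12 (.ld (.reg 13 + .lit 1)))
    (assign 11 (.bin .eq (.ld (.reg 13)) (.reg 11))))))

/-- The binary search step. -/
def midpoint : Expr := (.reg 8 + .reg 9) / .lit 2

/-- The program that determines the number of keys that are smaller than register `6`; the key with
the index in register `10` is the value of `kx`. -/
def rankProg (kx : Expr) : Prog :=
  .seq (assign 7 (.lit 1))
  (.seq (loopWhile (.bin .shr (.reg 6) (.reg 7)) (assign 7 (.reg 7 + .reg 7)))
  (.seq (assign 8 (.lit 0))
  (.seq (assign 9 (.reg 7))
  (.seq (loopWhile (.bin .lt (.reg 8) (.reg 9)) (.seq (assign 10 midpoint) (.seq lookup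
    (branch (.reg 11) (assign 9 (.reg 10)) (assign 8 (.reg 10 + .lit 1))))))
  (.seq (assign 10 (.reg 8))
  (.seq lookup
  (.seq (assign 8 (.reg 12))
  (.seq (assign 9 (.reg 8 + .reg 7))
  (.seq (branch (.bin .lt (.reg 4) (.reg 9)) (assign 9 (.reg 4)) .skip)
  (loopWhile (.bin .lt (.reg 8) (.reg 9)) (.seq (assign 10 midpoint)
    (branch (.bin .lt kx (.reg 6)) (assign 8 (.reg 10 + .lit 1)) (assign 9 (.reg 10))))))))))))))

/-- The memory contains a hash table with the keys `S` (smaller than `K`) and the values `val`. -/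
def IsDict (w : ℕ) (mem : List ℕ) (M K : ℕ) (S : Finset ℕ) (val : ℕ → ℕ) : Prop :=
  ∃ h P a m b₁ b₂, mem[0]? = some h ∧ mem[h]? = some M ∧ mem[h + 1]? = some P ∧
    mem[h + 2]? = some a ∧ mem[h + 3]? = some m ∧ mem[h + 4]? = some b₁ ∧ mem[h + 5]? = some b₂ ∧
    -- Absent keys are included, so failed look-ups are legal memory accesses; the product bounds
    -- exclude wrap-around.
    ∀ z < K, a * z < 2 ^ w ∧ ∃ o s c z' v, c * z < 2 ^ w ∧
      mem[b₁ + 3 * hash P m a z]? = some o ∧ mem[b₁ + 3 * hash P m a z + 1]? = some s ∧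
      mem[b₁ + 3 * hash P m a z + 2]? = some c ∧
      mem[b₂ + 2 * (o + hash P s c z)]? = some z' ∧
      mem[b₂ + 2 * (o + hash P s c z) + 1]? = some v ∧ (z' = z ↔ z ∈ S) ∧ (z ∈ S → v = val z)

/-- The key of the prefix `v` without the last `e` bits in the trie with number `t`. -/
def trieKey (M t e v : ℕ) : ℕ := (t * M + e) * M + v

section Programs
variable {w : ℕ} {mem : List ℕ} {V : ℕ → ℕ} {o : List ℕ}

theorem lt_length_of_getElem? {x v : ℕ} (h : mem[x]? = some v) : x < mem.length :=
  (List.getElem?_eq_some_iff.1 h).1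

theorem header_val {h j x : ℕ} (hlen : mem.length ≤ 2 ^ w) (h0 : mem[0]? = some h)
    (hj : mem[h + j]? = some x) : (header j).Val w mem V x := by
  have h1 := lt_length_of_getElem? hj
  exact .ld (.add (.ld (.lit (by positivity)) h0) (.lit (by omega)) (by omega)) hj

theorem lookup_spec {M K t e y : ℕ} {S : Finset ℕ} {val : ℕ → ℕ} (hlen : mem.length ≤ 2 ^ w)
    (hD : IsDict w mem M K S val) (hK : K ≤ 2 ^ w) (hz : trieKey M t e (y / 2 ^ e) < K)
    (hM : t * M + e < 2 ^ w)
    (ht : V 5 = t) (hy : V 6 = y) (he : V 10 = e) :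
    WP w mem lookup 200 (fun V' o' => o' = o ∧ (∀ r < 11, V' r = V r) ∧
      (V' 11 ≠ 0 ↔ trieKey M t e (y / 2 ^ e) ∈ S) ∧
      (trieKey M t e (y / 2 ^ e) ∈ S → V' 12 = val (trieKey M t e (y / 2 ^ e)))) V o := by
  obtain ⟨h, P, a, m, b₁, b₂, h0, hM0, hP, ha, hm, hb₁, hb₂, hD⟩ := hD
  set z := trieKey M t e (y / 2 ^ e) with hzdef
  obtain ⟨haz, f, s, c, z', v, hcz, hf, hs, hc, hz', hv, hmem, hval⟩ := hD z hz
  have hH : ∀ (W : ℕ → ℕ) (j x : ℕ), mem[h + j]? = some x → (header j).Val w mem W x :=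
    fun W j x => header_val hlen h0
  have l1 := lt_length_of_getElem? hc
  have l2 := lt_length_of_getElem? hv
  have l3 := lt_length_of_getElem? hb₂
  have l1' := l1
  have l2' := l2
  unfold hash at l1' l2'
  have hlt : z < 2 ^ w := hz.trans_le hK
  have ht' : t * M < 2 ^ w := by omega
  have hz2 : (t * M + e) * M < 2 ^ w := by
    rw [hzdef, trieKey] at hlt
    exact lt_of_le_of_lt (Nat.le_add_right _ _) hlt
  -- Symbolic execution of the five assignments; the holes are register reads and overflow bounds,
  -- the latter coming from successful loads in a memory of at most `2 ^ w` cells.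
  refine WP.mono (T := 200) (WP.mono (.seq (.assign (.add (.mul (.add (.mul (.reg ht) (hH _ 0 M hM0) ht')
    (.reg he) hM) (hH _ 0 M hM0) hz2) (.shr (.reg hy) (.reg he)) hlt) (.seq (.assign
    (.add (hH _ 4 _ hb₁) (.mul (.lit (by omega)) (.mod (.mod (.mul (hH _ 2 _ ha)
      (.reg (x := z) ?_) haz) (hH _ 1 _ hP)) (hH _ 3 _ hm)) ?_) ?_)
    (.seq (.assign (.add (hH _ 5 _ hb₂) (.mul (.lit (by omega)) (.add
      (.ld (.reg (x := b₁ + 3 * hash P m a z) ?_) hf)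
      (.mod (.mod (.mul (.ld (.add (.reg (x := b₁ + 3 * hash P m a z) ?_) (.lit (by omega)) ?_) hc)
        (.reg (x := z) ?_) hcz) (hH _ 1 _ hP))
        (.ld (.add (.reg (x := b₁ + 3 * hash P m a z) ?_) (.lit (by omega)) ?_) hs)) ?_) ?_) ?_)
    (.seq (.assign (.ld (.add (.reg (x := b₂ + 2 * (f + hash P s c z)) ?_) (.lit (by omega)) ?_) hv)
    (.assign (.eq (.ld (.reg (x := b₂ + 2 * (f + hash P s c z)) ?_) hz') (.reg (x := z) ?_))
      ?_))))))))) ?_ fun _ _ h => h) le_rfl fun _ _ h => h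
  all_goals first
    | rfl
    | omega
    | skip
  · refine ⟨rfl, fun r hr => ?_, ?_, fun h => ?_⟩
    · simp [show r ≠ 11 by omega, show r ≠ 12 by omega,
        show r ≠ 13 by omega]
    · simpa using hmem
    · simpa using hval h
  · decide

end Programs
-- Verification of the rank program.
section Rank
variable {w : ℕ} {mem : List ℕ} {V : ℕ → ℕ} {o : List ℕ}

/-- Binary search in the interval whose ends are in the registers `8` and `9`. -/
theorem WP.bsearch {P : Prog} {T : ℕ} (V : ℕ → ℕ) (Inv : ℕ → ℕ → Prop)
    (hle : ∀ lo hi, Inv lo hi → lo ≤ hi)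
    (hP : ∀ V' lo hi, (∀ r < 8, V' r = V r) → V' 8 = lo → V' 9 = hi → lo < hi → Inv lo hi →
      WP w mem P T (fun V'' o' => o' = o ∧ (∀ r < 8, V'' r = V r) ∧
        ((V'' 8 = lo ∧ V'' 9 = (lo + hi) / 2 ∧ Inv lo ((lo + hi) / 2)) ∨
          (V'' 8 = (lo + hi) / 2 + 1 ∧ V'' 9 = hi ∧ Inv ((lo + hi) / 2 + 1) hi))) V' o)
    (hV : Inv (V 8) (V 9)) :
    WP w mem (loopWhile (.bin .lt (.reg 8) (.reg 9)) P)
      ((T + 4) * Nat.size (V 9 - V 8) + 4)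
      (fun V' o' => o' = o ∧ (∀ r < 8, V' r = V r) ∧ Inv (V' 8) (V' 8)) V o := by
  refine WP.mono (WP.while_of_variant (T := T) (fun μ V' o' => o' = o ∧ (∀ r < 8, V' r = V r) ∧
    Inv (V' 8) (V' 9) ∧ μ = Nat.size (V' 9 - V' 8)) ?_ (μ := Nat.size (V 9 - V 8))
    ⟨rfl, fun _ _ => rfl, hV, rfl⟩) ?_ fun _ _ h => h
  · rintro μ V' o' ⟨rfl, hr, hI, rfl⟩
    have h1 := hle _ _ hI
    refine ⟨_, .lt (.reg rfl) (.reg rfl), fun h => ⟨rfl, hr, ?_⟩, fun h => ?_⟩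
    · have h2 : ¬ V' 8 < V' 9 := by simpa using h
      rwa [show V' 9 = V' 8 by omega] at hI
    · have h2 : V' 8 < V' 9 := by simpa using h
      refine (hP V' _ _ hr rfl rfl h2 hI).mono le_rfl ?_
      rintro V'' o'' ⟨h3, h4, h5⟩
      -- Halving the interval removes a binary digit from its length, the variant of the loop.
      have key : ∀ d, d ≤ (V' 9 - V' 8) / 2 → Nat.size d < Nat.size (V' 9 - V' 8) := by
        intro d hd
        have h6 : 0 < Nat.size (V' 9 - V' 8) := Nat.size_pos.2 (by omega)
        have h7 := Nat.lt_size_self (V' 9 - V' 8)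
        obtain ⟨n, hn⟩ := Nat.exists_eq_add_of_lt h6
        rw [hn, zero_add, pow_succ] at h7
        have h8 : Nat.size d ≤ n := by
          rw [Nat.size_le]
          omega
        omega
      rcases h5 with ⟨h5, h6, h7⟩ | ⟨h5, h6, h7⟩
      · exact ⟨_, key (V'' 9 - V'' 8) (by rw [h5, h6]; omega), h3, h4, by rwa [h5, h6], rfl⟩
      · exact ⟨_, key (V'' 9 - V'' 8) (by rw [h5, h6]; omega), h3, h4, by rwa [h5, h6], rfl⟩
  · simp only [Expr.cost]
    have : (1 + (1 + 1) + 1 + T) = T + 4 := by ring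
    rw [this]

theorem midpoint_val {lo hi : ℕ} (h8 : V 8 = lo) (h9 : V 9 = hi) (h : lo + hi < 2 ^ w)
    (h2 : 2 < 2 ^ w) : midpoint.Val w mem V ((lo + hi) / 2) :=
  .div (.add (.reg h8) (.reg h9) h) (.lit h2)

theorem rankProg_spec {a : ℕ → ℕ} {k y : ℕ} {kx : Expr} (hkx : kx.cost ≤ 20)
    (ha : ∀ x x', x < x' → x' < k → a x < a x')
    (h4 : V 4 = k) (h6 : V 6 = y) (hk : 2 * k + 2 ^ level y < 2 ^ w) (hw : 2 ^ (level y + 2) < 2 ^ w)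
    (hlook : ∀ V' e, (∀ r < 7, V' r = V r) → V' 10 = e → e ≤ 2 ^ level y →
      WP w mem lookup 200 (fun V'' o' => o' = o ∧ (∀ r < 11, V'' r = V' r) ∧
        (V'' 11 ≠ 0 ↔ Present a k e (y / 2 ^ e)) ∧
        (Present a k e (y / 2 ^ e) → V'' 12 = trieVal a k e (y / 2 ^ e))) V' o)
    (hkey : ∀ V', (∀ r < 7, V' r = V r) → V' 10 < k → kx.Val w mem V' (a (V' 10))) :
    WP w mem (rankProg kx) (1000 * (level y + 1))
      (fun V' o' => o' = o ∧ (∀ r < 7, V' r = V r) ∧ IsRank a k y (V' 8)) V o := by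
  set J := level y with hJ
  set b := 2 ^ J with hb
  have hb1 : 1 ≤ b := Nat.one_le_two_pow
  have hw' : 4 * b < 2 ^ w := by rw [pow_add] at hw; omega
  have hsize : Nat.size b = J + 1 := Nat.size_pow
  refine WP.mono (T := 2 + (8 * (J + 4) + (2 + (2 + (((240 + 4) * (J + 1) + 4) + (2 + (200 + (2 + (4 +
    (10 + ((60 + 4) * (J + 1) + 4))))))))))) ?_ (by omega) fun _ _ h => h
  refine .seq (.assign (.lit (by omega)) (.seq ?_))
  have hloop : WP w mem (loopWhile (.bin .shr (.reg 6) (.reg 7)) (assign 7 (.reg 7 + .reg 7)))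
      (8 * (J + 4)) (fun V' o' => o' = o ∧ (∀ r < 7, V' r = V r) ∧ V' 7 = b)
      (Function.update V 7 1) o := by
    refine WP.mono (WP.while_of_variant (T := 4) (μ := J) (fun μ V' o' => o' = o ∧
      (∀ r < 7, V' r = V r) ∧ ∃ i, V' 7 = 2 ^ i ∧ i + μ = J) ?_
      ⟨rfl, fun r hr => by simp [hr.ne], 0, by simp, by simp⟩) ?_ fun _ _ h => h
    · rintro μ V' o' ⟨rfl, hr, i, hi, hμ⟩
      refine ⟨_, .shr (.reg ((hr 6 (by norm_num)).trans h6)) (.reg hi), fun h => ?_, fun h => ?_⟩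
      · refine ⟨rfl, hr, ?_⟩
        have h1 : y < 2 ^ 2 ^ i := by
          rcases Nat.div_eq_zero_iff.1 h with h | h
          · simp at h
          · exact h
        rw [← level_le_iff] at h1
        rw [hi, show i = J by omega]
      · have h1 : ¬ y < 2 ^ 2 ^ i := fun h1 => h (Nat.div_eq_of_lt h1)
        rw [← level_le_iff] at h1
        have h2 : 2 ^ i + 2 ^ i = 2 ^ (i + 1) := by ring
        have h3 : 2 ^ (i + 1) ≤ b := Nat.pow_le_pow_right (by norm_num) (by omega)
        refine WP.mono (WP.assign (.add (.reg hi) (.reg hi) (by omega))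
          ⟨μ - 1, by omega, rfl, fun r hr' => ?_, i + 1, ?_, by omega⟩) le_rfl fun _ _ h => h
        · simp [hr'.ne, hr r hr']
        · simp [h2]
    · simp only [Expr.cost]
      omega
  refine hloop.mono le_rfl ?_
  rintro V₁ o₁ ⟨rfl, hr₁, h7⟩
  refine .seq (.assign (.lit (by omega)) (.seq (.assign (.reg (x := b) (by simp [h7])) (.seq ?_))))
  set V₂ := Function.update (Function.update V₁ 8 0) 9 b with hV₂
  have hV₂r : ∀ r < 8, V₂ r = V₁ r := fun r hr => by
    simp [hV₂, hr.ne, show r ≠ 9 by omega]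
  have hV₂8 : V₂ 8 = 0 := by simp [hV₂]
  have hV₂9 : V₂ 9 = b := by simp [hV₂]
  -- When `lo = hi`, this says that `lo` is the first depth at which the prefix of `y` is present.
  let Inv₁ : ℕ → ℕ → Prop := fun lo hi => lo ≤ hi ∧ hi ≤ b ∧
    (∀ e < lo, ¬ Present a k e (y / 2 ^ e)) ∧ Present a k hi (y / 2 ^ hi)
  have hs₁ := WP.bsearch (w := w) (mem := mem) (o := o₁) (T := 240)
    (P := .seq (assign 10 midpoint) (.seq lookup
      (branch (.reg 11) (assign 9 (.reg 10)) (assign 8 (.reg 10 + .lit 1))))) V₂ Inv₁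
    (fun lo hi h => h.1) ?_ ?_
  rotate_left
  · rintro V' lo hi hr h8 h9 hlt ⟨h10, h11, h12, h13⟩
    refine WP.mono (T := 6 + (200 + 20)) (WP.seq (WP.assign (midpoint_val (w := w) h8 h9 (by omega) (by omega))
      (WP.seq ?_))) (by omega) fun _ _ h => h
    set m := (lo + hi) / 2 with hm
    refine (hlook _ m (fun r hr' => ?_) (by simp) (by omega)).mono le_rfl ?_
    · simp [show r ≠ 10 by omega, hr r (by omega), hV₂r r (by omega), hr₁ r hr']
    · rintro V'' o' ⟨rfl, hr'', h14, -⟩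
      have e10 : V'' 10 = m := by rw [hr'' 10 (by norm_num)]; simp
      have e8 : V'' 8 = lo := by rw [hr'' 8 (by norm_num)]; simp [h8]
      have e9 : V'' 9 = hi := by rw [hr'' 9 (by norm_num)]; simp [h9]
      have er : ∀ r < 8, V'' r = V₂ r := fun r hr' => by
        rw [hr'' r (by omega), ← hr r hr']; simp [show r ≠ 10 by omega]
      refine WP.mono (WP.branch (T := 6) (.reg rfl) (fun hp => ?_) fun hp => ?_) (by simp [Expr.cost])
        fun _ _ h => h
      · refine WP.mono (WP.assign (.reg e10) ⟨rfl, fun r hr' => ?_, .inl ⟨?_, ?_, ?_⟩⟩)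
          (by simp [Expr.cost]) fun _ _ h => h
        · simp [show r ≠ 9 by omega, er r hr']
        · simp [e8]
        · simp
        · exact ⟨by omega, by omega, h12, h14.1 hp⟩
      · refine WP.mono (WP.assign (.add (.reg e10) (.lit (by omega)) (by omega))
          ⟨rfl, fun r hr' => ?_, .inr ⟨?_, ?_, ?_⟩⟩) (by decide) fun _ _ h => h
        · simp [show r ≠ 8 by omega, er r hr']
        · simp
        · simp [e9]
        · refine ⟨by omega, h11, fun e he hpe => ?_, h13⟩
          exact h14.not.1 (by simpa using hp) (hpe.mono (by omega))
  · rw [hV₂8, hV₂9]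
    -- At depth `2 ^ level y` the prefix of `y` is `0`, which counts as present.
    refine ⟨by omega, le_rfl, by simp, .inl (Nat.div_eq_of_lt (lt_two_pow_level y))⟩
  rw [hV₂8, hV₂9, Nat.sub_zero, hsize] at hs₁
  refine hs₁.mono le_rfl ?_
  rintro V₃ o₃ ⟨rfl, hr₃, -, h8, hnot, hpres⟩
  refine .seq (.assign (.reg rfl) (.seq ?_))
  refine (hlook _ (V₃ 8) (fun r hr => ?_) (by simp) h8).mono le_rfl ?_
  · simp [show r ≠ 10 by omega, hr₃ r (by omega), hV₂r r (by omega), hr₁ r hr]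
  rintro V₄ o₄ ⟨rfl, hr₄, -, h12⟩
  have h12 := h12 hpres
  rw [trieVal_eq hnot] at h12
  have hr₄' : ∀ r < 7, V₄ r = V r := fun r hr => by
    rw [hr₄ r (by omega), ← hr₁ r hr, ← hV₂r r (by omega), ← hr₃ r (by omega)]
    simp [show r ≠ 10 by omega]
  have h47 : V₄ 7 = b := by
    rw [hr₄ 7 (by omega), ← h7, ← hV₂r 7 (by omega), ← hr₃ 7 (by omega)]
    simp
  set G := repBelow a k y with hG
  have hGk : G ≤ k := repBelow_le _ _ _
  refine .seq (.assign (.reg h12) (.seq (WP.assign (v := G + b) (.add (.reg (by simp))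
    (.reg (by simp [h47])) (by omega)) (.seq ?_))))
  set V' := Function.update (Function.update V₄ 8 G) 9 (G + b) with hV'
  have hV'r : ∀ r < 7, V' r = V r := fun r hr => by
    simp [hV', show r ≠ 8 by omega, show r ≠ 9 by omega, hr₄' r hr]
  have hV'8 : V' 8 = G := by simp [hV']
  have hV'9 : V' 9 = G + b := by simp [hV']
  have hmin : WP w mem (branch (.bin .lt (.reg 4) (.reg 9)) (assign 9 (.reg 4)) .skip) 10
      (fun V'' o' => o' = o₄ ∧ (∀ r < 7, V'' r = V r) ∧ V'' 8 = G ∧ V'' 9 = min k (G + b)) V' o₄ := by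
    refine WP.mono (WP.branch (T := 2) (.lt (.reg ((hV'r 4 (by norm_num)).trans h4)) (.reg hV'9))
      (fun hv => ?_) fun hv => ?_) (by decide) fun _ _ h => h
    · have : k < G + b := by simpa using hv
      refine WP.assign (.reg ((hV'r 4 (by norm_num)).trans h4)) ⟨rfl, fun r hr => ?_, ?_, ?_⟩
      · simp [show r ≠ 9 by omega, hV'r r hr]
      · simp [hV'8]
      · simp [this.le]
    · have : ¬ k < G + b := by simpa using hv
      refine (WP.skip ⟨rfl, hV'r, hV'8, ?_⟩).mono (by omega) fun _ _ h => h
      rw [hV'9, min_eq_right (not_lt.1 this)]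
  refine hmin.mono le_rfl ?_
  rintro V₅ o₅ ⟨rfl, hr₅, h58, h59⟩
  -- The rank lies between `lo` and `hi`; initially these are `G` and `min k (G + b)`.
  let Inv₂ : ℕ → ℕ → Prop := fun lo hi => lo ≤ hi ∧ hi ≤ k ∧
    (∀ x < lo, a x < y) ∧ ∀ x, hi ≤ x → x < k → y ≤ a x
  have hs₂ := WP.bsearch (w := w) (mem := mem) (o := o₅) (T := 60)
    (P := .seq (assign 10 midpoint) (branch (.bin .lt kx (.reg 6)) (assign 8 (.reg 10 + .lit 1))
      (assign 9 (.reg 10)))) V₅ Inv₂ (fun lo hi h => h.1) ?_ ?_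
  · refine hs₂.mono ?_ ?_
    · have h1 : V₅ 9 - V₅ 8 ≤ b := by omega
      have h2 := Nat.size_le_size h1
      rw [hsize] at h2
      omega
    · rintro V' o' ⟨rfl, hr, -, h1, h2, h3⟩
      exact ⟨rfl, fun r hr' => (hr r (by omega)).trans (hr₅ r hr'), h1, h2, h3⟩
  · rintro V' lo hi hr h8 h9 hlt ⟨h10, h11, h12, h13⟩
    refine WP.mono (T := 6 + 40) (WP.seq (WP.assign (midpoint_val (w := w) h8 h9 (by omega) (by omega)) ?_))
      (by omega) fun _ _ h => h
    set m := (lo + hi) / 2 with hm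
    have er : ∀ r < 7, Function.update V' 10 m r = V r := fun r hr' => by
      simp [show r ≠ 10 by omega, hr r (by omega), hr₅ r hr']
    have hv := hkey (Function.update V' 10 m) er (by simp; omega)
    rw [Function.update_self] at hv
    refine WP.mono (WP.branch (T := 6) (.lt hv (.reg (x := y) ((er 6 (by norm_num)).trans h6)))
      (fun hp => ?_) fun hp => ?_) (by simp [Expr.cost]; omega) fun _ _ h => h
    · have hp : a m < y := by simpa using hp
      refine WP.mono (WP.assign (.add (.reg (x := m) (by simp)) (.lit (by omega)) (by omega))
          ⟨rfl, fun r hr' => ?_, .inr ⟨?_, ?_, ?_⟩⟩) (by decide) fun _ _ h => h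
      · simp [show r ≠ 8 by omega, show r ≠ 10 by omega, hr r hr']
      · simp
      · simp [h9]
      · refine ⟨by omega, h11, fun x hx => ?_, h13⟩
        rcases (Nat.lt_succ_iff.1 hx).eq_or_lt with rfl | hx
        · exact hp
        · exact (ha _ _ hx (by omega)).trans hp
    · have hp : y ≤ a m := by simpa using hp
      refine WP.mono (WP.assign (.reg (x := m) (by simp)) ⟨rfl, fun r hr' => ?_, .inl ⟨?_, ?_, ?_⟩⟩)
          (by simp [Expr.cost]) fun _ _ h => h
      · simp [show r ≠ 9 by omega, show r ≠ 10 by omega, hr r hr']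
      · simp [h8]
      · simp
      · refine ⟨by omega, by omega, h12, fun x hx hxk => ?_⟩
        rcases hx.eq_or_lt with h | hx
        · rwa [← h]
        · exact hp.trans (ha _ _ hx hxk).le
  · rw [h58, h59]
    refine ⟨by omega, by omega, fun x hx => lt_of_lt_repBelow ha hx, fun x hx hxk => ?_⟩
    exact le_of_repBelow_add_le ha (show G + b ≤ x by omega) hxk

end Rank
-- The lists as sorted arrays, and the meaning of ranks in them.
section Lists
variable {α : Type*} {s : List α} {p : ℕ}

theorem exists_repeatList (s : List α) (p : ℕ) : ∃ L : List (ℕ × ℕ),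
    L.Pairwise (fun x y => x.2 < y.2) ∧ (∀ x, x ∈ L ↔ x ∈ repeatsInto s p) ∧
      L.length = #(repeatsFinset s p) := by
  classical
  let T := (repeatsFinset s p).image Prod.snd
  have hT : ∀ t ∈ T, ∃ q, IsRightClosedRepeat s q t p := by
    intro t ht
    obtain ⟨⟨q, t'⟩, hx, rfl⟩ := mem_image.1 ht
    exact ⟨q, mem_repeatsFinset.1 hx⟩
  choose! f hf using hT
  refine ⟨(T.sort (· ≤ ·)).map fun t => (f t, t), ?_, fun x => ?_, ?_⟩
  · rw [List.pairwise_map]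
    exact T.sortedLT_sort.pairwise
  · simp only [List.mem_map, mem_sort]
    constructor
    · rintro ⟨t, ht, rfl⟩
      exact hf t ht
    · intro hx
      have ht : x.2 ∈ T := mem_image.2 ⟨x, mem_repeatsFinset.2 hx, rfl⟩
      exact ⟨x.2, ht, Prod.ext ((hf _ ht).left_unique hx) rfl⟩
  · rw [List.length_map, length_sort]
    refine card_image_of_injOn fun x hx y hy h => ?_
    rw [Finset.mem_coe, mem_repeatsFinset] at hx hy
    rw [h] at hx
    exact Prod.ext (hx.left_unique hy) h

/-- The list of the right closed repeats whose next occurrence is at `p`. -/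
noncomputable def repeatList (s : List α) (p : ℕ) : List (ℕ × ℕ) := (exists_repeatList s p).choose

theorem pairwise_repeatList : (repeatList s p).Pairwise (fun x y => x.2 < y.2) :=
  (exists_repeatList s p).choose_spec.1

theorem mem_repeatList {x : ℕ × ℕ} : x ∈ repeatList s p ↔ x ∈ repeatsInto s p :=
  (exists_repeatList s p).choose_spec.2.1 x

theorem length_repeatList : (repeatList s p).length = #(repeatsFinset s p) :=
  (exists_repeatList s p).choose_spec.2.2

/-- The `x`-th right closed repeat whose next occurrence is at `p`. -/
noncomputable def entry (s : List α) (p x : ℕ) : ℕ × ℕ := (repeatList s p).getD x (0, 0)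

theorem entry_eq {x : ℕ} (hx : x < (repeatList s p).length) : entry s p x = (repeatList s p)[x] := by
  simp [entry, hx]

theorem entry_mem {x : ℕ} (hx : x < (repeatList s p).length) : entry s p x ∈ repeatsInto s p := by
  rw [entry_eq hx, ← mem_repeatList]
  exact List.getElem_mem hx

theorem exists_entry {z : ℕ × ℕ} (hz : z ∈ repeatsInto s p) :
    ∃ x < (repeatList s p).length, entry s p x = z := by
  obtain ⟨x, hx, rfl⟩ := List.getElem_of_mem (mem_repeatList.2 hz)
  exact ⟨x, hx, entry_eq hx⟩

theorem entry_snd_lt {x y : ℕ} (hxy : x < y) (hy : y < (repeatList s p).length) :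
    (entry s p x).2 < (entry s p y).2 := by
  rw [entry_eq hy, entry_eq (hxy.trans hy)]
  exact List.pairwise_iff_getElem.1 pairwise_repeatList x y (hxy.trans hy) hy hxy

theorem entry_fst_lt {x y : ℕ} (hxy : x < y) (hy : y < (repeatList s p).length) :
    (entry s p y).1 < (entry s p x).1 :=
  IsRightClosedRepeat.lt_of_lt (entry_mem (hxy.trans hy)) (entry_mem hy) (entry_snd_lt hxy hy)

/-- The keys of the two tries of the list of `p`: the distances for `c = 0` and the lengths for
`c = 1`. -/
noncomputable def trieKeys (s : List α) (p c x : ℕ) : ℕ :=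
  if c = 0 then p - (entry s p x).1 else (entry s p x).2

/-- Since `q` decreases along the list, the distances `p - q` increase; one order of the list serves
both searches. -/
theorem trieKeys_lt {c x y : ℕ} (hxy : x < y) (hy : y < (repeatList s p).length) :
    trieKeys s p c x < trieKeys s p c y := by
  unfold trieKeys
  split_ifs
  · have h1 := entry_fst_lt hxy hy
    have h2 := (entry_mem (hxy.trans hy)).2.2.1
    omega
  · exact entry_snd_lt hxy hy

theorem trieKeys_le {c x : ℕ} (hx : x < (repeatList s p).length) :
    trieKeys s p c x ≤ s.length := by
  obtain ⟨h1, h2, h3, h4, -⟩ := entry_mem hx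
  unfold trieKeys
  split_ifs <;> omega

theorem length_repeatList_le : (repeatList s p).length ≤ s.length := by
  classical
  rw [length_repeatList]
  have h : #(repeatsFinset s p) ≤ #(Icc 1 s.length) := by
    refine card_le_card_of_injOn Prod.snd (fun x hx => ?_) fun x hx y hy h => ?_
    · rw [Finset.mem_coe, mem_repeatsFinset] at hx
      obtain ⟨h1, h2, h3, h4, -⟩ := hx
      simp only [coe_Icc, Set.mem_Icc]
      omega
    · rw [Finset.mem_coe, mem_repeatsFinset] at hx hy
      rw [h] at hx
      exact Prod.ext (hx.left_unique hy) h
  simpa using h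

theorem lt_rank_distance_iff {i r x : ℕ} (hip : i ≤ p)
    (hr : IsRank (trieKeys s p 0) (repeatList s p).length (p - i + 1) r)
    (hx : x < (repeatList s p).length) : x < r ↔ i ≤ (entry s p x).1 := by
  have h2 := (entry_mem hx).2.2.1
  obtain ⟨-, h3, h4⟩ := hr
  constructor
  · intro h
    have := h3 x h
    simp only [trieKeys, if_true] at this
    omega
  · intro h
    by_contra! hc
    have := h4 x hc hx
    simp only [trieKeys, if_true] at this
    omega

theorem fst_lt_of_rank_distance_eq_zero {i : ℕ} (hip : i ≤ p)
    (hr : IsRank (trieKeys s p 0) (repeatList s p).length (p - i + 1) 0) :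
    ∀ z ∈ repeatsInto s p, z.1 < i := by
  intro z hz
  obtain ⟨x, hx, rfl⟩ := exists_entry hz
  have := lt_rank_distance_iff hip hr hx
  omega

/-- The entries before the rank of `p - i + 1` are those with `q ≥ i`. The last of them has the
least such `q` and, by the staircase property, the greatest length. -/
theorem entry_of_rank_distance {i r : ℕ} (hip : i ≤ p)
    (hr : IsRank (trieKeys s p 0) (repeatList s p).length (p - i + 1) (r + 1)) :
    entry s p r ∈ repeatsInto s p ∧ i ≤ (entry s p r).1 ∧
      ∀ z ∈ repeatsInto s p, i ≤ z.1 → (entry s p r).1 ≤ z.1 ∧ z.2 ≤ (entry s p r).2 := by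
  have hrk : r < (repeatList s p).length := hr.1
  refine ⟨entry_mem hrk, (lt_rank_distance_iff hip hr hrk).1 (by omega), fun z hz hiz => ?_⟩
  obtain ⟨x, hx, rfl⟩ := exists_entry hz
  have h1 := (lt_rank_distance_iff hip hr hx).2 hiz
  rcases (Nat.lt_succ_iff.1 h1).eq_or_lt with rfl | h
  · exact ⟨le_rfl, le_rfl⟩
  · exact ⟨(entry_fst_lt h hrk).le, (entry_snd_lt h hrk).le⟩

theorem entry_of_rank_length {m r : ℕ}
    (hr : IsRank (trieKeys s p 1) (repeatList s p).length m r) (hrk : r < (repeatList s p).length) :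
    entry s p r ∈ repeatsInto s p ∧ m ≤ (entry s p r).2 ∧
      ∀ z ∈ repeatsInto s p, m ≤ z.2 → (entry s p r).2 ≤ z.2 := by
  refine ⟨entry_mem hrk, hr.2.2 r le_rfl hrk, fun z hz hmz => ?_⟩
  obtain ⟨x, hx, rfl⟩ := exists_entry hz
  have h1 : ¬ x < r := fun h => (hr.2.1 x h).not_ge hmz
  rcases (not_lt.1 h1).eq_or_lt with rfl | h
  · exact le_rfl
  · exact (entry_snd_lt h hx).le

theorem snd_lt_of_rank_length {m r : ℕ}
    (hr : IsRank (trieKeys s p 1) (repeatList s p).length m r) (hrk : ¬ r < (repeatList s p).length) :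
    ∀ z ∈ repeatsInto s p, z.2 < m := by
  intro z hz
  obtain ⟨x, hx, rfl⟩ := exists_entry hz
  exact hr.2.1 x (by omega)

end Lists

/-! ## The query programs -/

/-- The address of the first (for `j = 1`) or second (for `j = 2`) component of the pair whose index
is in register `r`. -/
def pairAddr (j r : ℕ) : Expr := .reg 3 + .lit j + (.reg r + .reg r)

/-- The key with the index in register `10`. -/
def keyExpr : ℕ → Expr
  | 0 => .reg 2 - .ld (pairAddr 1 10)
  | _ => .ld (pairAddr 2 10)

/-- The search in the list of the position in register `2` for the value in register `6`. -/
def search (c : ℕ) : Prog :=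
  .seq (assign 3 (.ld (.reg 2))) (.seq (assign 4 (.ld (.reg 3)))
    (.seq (assign 5 (.reg 2 + .reg 2 + .lit c)) (rankProg (keyExpr c))))

/-- The memory `mem` represents the lists of the right closed repeats of `s`, at the addresses
`addr`, and their tries. -/
structure Stored {α : Type*} (w : ℕ) (mem : List ℕ) (s : List α) (addr : ℕ → ℕ) (g : ℕ)
    (S : Finset ℕ) (val : ℕ → ℕ) : Prop where
  length_le : mem.length ≤ 2 ^ w
  one_le : 1 ≤ g
  lt_two_pow : s.length < 2 ^ g
  -- Trie numbers are below `2 * 2 ^ g`, depths and prefixes below `2 ^ g`, so every trie key fits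
  -- into a word.
  two_pow_le : 2 * (2 ^ g) ^ 3 ≤ 2 ^ w
  four_lt : 4 * 2 ^ g < 2 ^ w
  addr_eq : ∀ p, 1 ≤ p → p ≤ s.length → mem[p]? = some (addr p)
  length_eq : ∀ p, 1 ≤ p → p ≤ s.length → mem[addr p]? = some (repeatList s p).length
  fst_eq : ∀ p, 1 ≤ p → p ≤ s.length → ∀ x < (repeatList s p).length,
    mem[addr p + 1 + (x + x)]? = some (entry s p x).1
  snd_eq : ∀ p, 1 ≤ p → p ≤ s.length → ∀ x < (repeatList s p).length,
    mem[addr p + 2 + (x + x)]? = some (entry s p x).2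
  dict : IsDict w mem (2 ^ g) (2 * (2 ^ g) ^ 3) S val
  mem_dict : ∀ p, 1 ≤ p → p ≤ s.length → ∀ c < 2, ∀ e < 2 * g, ∀ v < 2 ^ g,
    trieKey (2 ^ g) (p + p + c) e v ∈ S ↔ Present (trieKeys s p c) (repeatList s p).length e v
  val_dict : ∀ p, 1 ≤ p → p ≤ s.length → ∀ c < 2, ∀ e < 2 * g, ∀ v < 2 ^ g,
    Present (trieKeys s p c) (repeatList s p).length e v →
    val (trieKey (2 ^ g) (p + p + c) e v) = trieVal (trieKeys s p c) (repeatList s p).length e v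

section Queries
variable {α : Type*} {w : ℕ} {mem : List ℕ} {s : List α} {addr : ℕ → ℕ} {g : ℕ} {S : Finset ℕ}
  {val : ℕ → ℕ} {V : ℕ → ℕ} {o : List ℕ} {p : ℕ}

theorem pairAddr_val {j r a x : ℕ} (hr : r < 50) (h3 : V 3 = a) (hx : V r = x) (hj : j < 2 ^ w)
    (h : a + j + (x + x) < 2 ^ w) : (pairAddr j r).Val w mem V (a + j + (x + x)) :=
  .add (.add (.reg h3) (.lit hj) (by omega)) (.add (.reg hx hr) (.reg hx hr) (by omega)) h

theorem Stored.fst_val (hS : Stored w mem s addr g S val) (hp : 1 ≤ p) (hp' : p ≤ s.length)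
    {r x : ℕ} (hr : r < 50) (h3 : V 3 = addr p) (hx : V r = x) (hxk : x < (repeatList s p).length) :
    (Expr.ld (pairAddr 1 r)).Val w mem V (entry s p x).1 := by
  have h := hS.fst_eq p hp hp' x hxk
  have h1 := lt_length_of_getElem? h
  have h2 := hS.length_le
  exact .ld (pairAddr_val hr h3 hx (by omega) (by omega)) h

theorem Stored.snd_val (hS : Stored w mem s addr g S val) (hp : 1 ≤ p) (hp' : p ≤ s.length)
    {r x : ℕ} (hr : r < 50) (h3 : V 3 = addr p) (hx : V r = x) (hxk : x < (repeatList s p).length) :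
    (Expr.ld (pairAddr 2 r)).Val w mem V (entry s p x).2 := by
  have h := hS.snd_eq p hp hp' x hxk
  have h1 := lt_length_of_getElem? h
  have h2 := hS.length_le
  exact .ld (pairAddr_val hr h3 hx (by omega) (by omega)) h

theorem Stored.keyExpr_val (hS : Stored w mem s addr g S val) (hp : 1 ≤ p) (hp' : p ≤ s.length)
    {c x : ℕ} (h2 : V 2 = p) (h3 : V 3 = addr p) (hx : V 10 = x)
    (hxk : x < (repeatList s p).length) : (keyExpr c).Val w mem V (trieKeys s p c x) := by
  have h := hS.lt_two_pow
  have h' := hS.four_lt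
  rcases c with _ | c
  · have h4 := (entry_mem hxk).2.2.1
    exact .congr (.sub (.reg h2) (hS.fst_val hp hp' (by norm_num) h3 hx hxk) h4.le (by omega))
      (by simp [trieKeys])
  · exact .congr (hS.snd_val hp hp' (by norm_num) h3 hx hxk) (by simp [trieKeys])

theorem Stored.search_spec (hS : Stored w mem s addr g S val) (hp : 1 ≤ p) (hp' : p ≤ s.length)
    {c y : ℕ} (hc : c < 2) (hy : y ≤ s.length) (h2 : V 2 = p) (h6 : V 6 = y) :
    WP w mem (search c) (1020 * (level y + 1)) (fun V' o' => o' = o ∧ V' 0 = V 0 ∧ V' 1 = V 1 ∧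
      V' 2 = p ∧ V' 3 = addr p ∧ V' 4 = (repeatList s p).length ∧
      IsRank (trieKeys s p c) (repeatList s p).length y (V' 8)) V o := by
  have hg := hS.lt_two_pow
  have hw := hS.four_lt
  have hw3 := hS.two_pow_le
  have hk := length_repeatList_le (s := s) (p := p)
  have hlev := two_pow_level_le hS.one_le (hy.trans_lt hg)
  have hgg : 2 * g ≤ 2 ^ g := by
    obtain ⟨g', hg'⟩ := Nat.exists_eq_add_of_le' hS.one_le
    have := Nat.lt_two_pow_self (n := g')
    rw [hg', pow_succ]
    omega
  refine WP.mono (T := 3 + (3 + (6 + 1000 * (level y + 1)))) (WP.seq (WP.assign (v := addr p)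
    (.ld (.reg h2) (hS.addr_eq p hp hp')) (WP.seq (WP.assign (v := (repeatList s p).length)
    (.ld (.reg (by simp)) (hS.length_eq p hp hp')) (WP.seq (WP.assign (v := p + p + c)
    (.add (.add (.reg (by simp [h2])) (.reg (by simp [h2])) (by omega)) (.lit (by omega))
      (by omega)) ?_)))))) (by omega) fun _ _ h => h
  set V₁ := Function.update (Function.update (Function.update V 3 (addr p)) 4
    (repeatList s p).length) 5 (p + p + c) with hV₁
  have e0 : V₁ 0 = V 0 := by simp [hV₁]
  have e1 : V₁ 1 = V 1 := by simp [hV₁]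
  have e2 : V₁ 2 = p := by simp [hV₁, h2]
  have e3 : V₁ 3 = addr p := by simp [hV₁]
  have e4 : V₁ 4 = (repeatList s p).length := by simp [hV₁]
  have e5 : V₁ 5 = p + p + c := by simp [hV₁]
  have e6 : V₁ 6 = y := by simp [hV₁, h6]
  refine (rankProg_spec (a := trieKeys s p c) (k := (repeatList s p).length) (y := y) ?_
    (fun x x' h h' => trieKeys_lt h h') e4 e6 (by omega) ?_ (fun V' e hV' h10 he => ?_)
    fun V' hV' h10 => ?_).mono le_rfl ?_
  · rcases c with _ | c
    · decide
    · change (Expr.ld (pairAddr 2 10)).cost ≤ 20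
      decide
  · rw [pow_add]; omega
  · have hv : y / 2 ^ e < 2 ^ g := (Nat.div_le_self _ _).trans_lt (by omega)
    have he' : e < 2 * g := by omega
    have hte : ∀ v < 2 ^ g, trieKey (2 ^ g) (p + p + c) e v < 2 * (2 ^ g) ^ 3 := by
      intro v hv
      have h1 : (p + p + c) * 2 ^ g + e < 2 * 2 ^ g * 2 ^ g := by
        have : (p + p + c + 1) * 2 ^ g ≤ 2 * 2 ^ g * 2 ^ g := Nat.mul_le_mul_right _ (by omega)
        rw [add_mul (p + p + c)] at this
        omega
      have h2 := Nat.mul_le_mul_right (2 ^ g) (Nat.succ_le_of_lt h1)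
      have h3 : 2 * 2 ^ g * 2 ^ g * 2 ^ g = 2 * (2 ^ g) ^ 3 := by ring
      rw [Nat.succ_mul, h3] at h2
      unfold trieKey
      omega
    have hlt := hte _ hv
    refine (lookup_spec hS.length_le hS.dict hw3 hlt ?_ ((hV' 5 (by norm_num)).trans e5)
      ((hV' 6 (by norm_num)).trans e6) h10).mono le_rfl ?_
    · have h0 := hte 0 (by positivity)
      have h1 : (p + p + c) * 2 ^ g + e ≤ trieKey (2 ^ g) (p + p + c) e 0 :=
        Nat.le_mul_of_pos_right _ (by positivity)
      omega
    · rintro V'' o' ⟨rfl, h1, h2, h3⟩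
      rw [hS.mem_dict p hp hp' c hc e he' _ hv] at h2 h3
      exact ⟨rfl, h1, h2, fun h => (h3 h).trans (hS.val_dict p hp hp' c hc e he' _ hv h)⟩
  · exact hS.keyExpr_val hp hp' ((hV' 2 (by norm_num)).trans e2) ((hV' 3 (by norm_num)).trans e3)
      rfl h10
  · rintro V' o' ⟨rfl, h1, h2⟩
    exact ⟨rfl, (h1 0 (by norm_num)).trans e0, (h1 1 (by norm_num)).trans e1,
      (h1 2 (by norm_num)).trans e2, (h1 3 (by norm_num)).trans e3, (h1 4 (by norm_num)).trans e4, h2⟩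

end Queries
/-- The program that outputs the pair of a list with the least position that is at least `i`. -/
def succPosProg : Prog :=
  .seq (assign 2 (.reg 0)) (.seq (assign 6 (.reg 0 - .reg 1 + .lit 1)) (.seq (search 0)
    (branch (.reg 8) (.seq (assign 8 (.reg 8 - .lit 1))
      (.seq (output (.ld (pairAddr 1 8))) (output (.ld (pairAddr 2 8)))))
      (.seq (output (.lit 0)) (output (.lit 0))))))

/-- The program that outputs the pair of a list with the least length that is at least `m`. -/
def succLenProg : Prog :=
  .seq (assign 2 (.reg 0)) (.seq (assign 6 (.reg 1)) (.seq (search 1)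
    (branch (.bin .lt (.reg 8) (.reg 4))
      (.seq (output (.ld (pairAddr 1 8))) (output (.ld (pairAddr 2 8))))
      (.seq (output (.lit 0)) (output (.lit 0))))))

/-- The program that determines the source (in register `14`, relative to the beginning of the parsed
substring) and the length (in register `15`) of the phrase at the position in register `2`. -/
def phraseProg : Prog :=
  .seq (assign 6 (.reg 2 - .reg 0 + .lit 1)) (.seq (search 0)
    (branch (.reg 8)
      (.seq (assign 8 (.reg 8 - .lit 1)) (.seq (assign 14 (.ld (pairAddr 1 8)))
        (.seq (assign 15 (.ld (pairAddr 2 8)))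
        (.seq (branch (.bin .lt (.reg 0 + .reg 1) (.reg 2 + .reg 15))
          (.seq (assign 6 (.reg 0 + .reg 1 - .reg 2)) (.seq (search 1)
            (.seq (assign 14 (.ld (pairAddr 1 8))) (assign 15 (.reg 0 + .reg 1 - .reg 2)))))
          .skip)
        (assign 14 (.reg 14 - .reg 0 + .lit 1))))))
      (.seq (assign 14 (.lit 0)) (assign 15 (.lit 1)))))

/-- The program that outputs the rightmost LZ77 parsing of a substring. -/
def parseProg : Prog :=
  .seq (assign 2 (.reg 0)) (loopWhile (.bin .lt (.reg 2) (.reg 0 + .reg 1))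
    (.seq phraseProg (.seq (output (.reg 2 - .reg 0 + .lit 1)) (.seq (output (.reg 15))
      (.seq (output (.reg 14)) (assign 2 (.reg 2 + .reg 15)))))))

section Queries
variable {α : Type*} {w : ℕ} {mem : List ℕ} {s : List α} {addr : ℕ → ℕ} {g : ℕ} {S : Finset ℕ}
  {val : ℕ → ℕ} {V : ℕ → ℕ} {o : List ℕ} {p : ℕ}

theorem Stored.succPos_spec (hS : Stored w mem s addr g S val) {i : ℕ} (hi : 1 ≤ i) (hip : i < p)
    (hp : p ≤ s.length) : ∃ r, IsFirstFrom (repeatsInto s p) Prod.fst i r ∧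
      Answers w succPosProg mem p i (repeatWords r) (10000 * lg (lg ((p - i : ℕ) : ℝ))) := by
  have hg := hS.lt_two_pow
  have hw := hS.four_lt
  set V₀ : ℕ → ℕ := fun r => if r = 0 then p else if r = 1 then i else 0 with hV₀
  set y := p - i + 1 with hy
  have hmain : ∃ r, IsFirstFrom (repeatsInto s p) Prod.fst i r ∧
      WP w mem succPosProg (1100 * (level y + 1)) (fun _ o => o = repeatWords r) V₀ [] := by
    obtain ⟨V₁, o₁, ⟨rfl, h0, h1, h2, h3, h4, hr⟩, hexec⟩ := hS.search_spec (o := [])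
      (V := Function.update (Function.update V₀ 2 p) 6 y) (by omega) hp (c := 0) (y := y)
      (by norm_num) (by omega) (by simp) (by simp)
    have hseq : ∀ {P Q}, WP w mem P 30 Q V₁ [] →
        WP w mem (.seq (assign 2 (.reg 0)) (.seq (assign 6 (.reg 0 - .reg 1 + .lit 1)) (.seq (search 0) P)))
          (1100 * (level y + 1)) Q V₀ [] := by
      intro P Q hP
      exact WP.mono (T := 2 + (6 + (1020 * (level y + 1) + 30))) (WP.seq (WP.assign (v := p)
        (.reg (by simp [hV₀])) (WP.seq (WP.assign (v := y) (.add (.sub (.reg (x := p) (by simp [hV₀]))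
        (.reg (x := i) (by simp [hV₀])) hip.le (by omega)) (.lit (by omega)) (by omega))
        (WP.seq ⟨V₁, [], hP, hexec⟩))))) (by omega) fun _ _ h => h
    rcases hr8 : V₁ 8 with _ | r
    · rw [hr8] at hr
      refine ⟨none, fst_lt_of_rank_distance_eq_zero hip.le hr, hseq ?_⟩
      exact WP.mono (WP.branch (T := 4) (.reg hr8) (fun h => absurd rfl h) fun _ =>
        WP.seq (WP.output (.lit (by omega)) (WP.output (.lit (by omega)) rfl))) (by decide)
        fun _ _ h => h
    · rw [hr8] at hr
      obtain ⟨h5, h6, h7⟩ := entry_of_rank_distance hip.le hr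
      have hrk := hr.1
      have hk := length_repeatList_le (s := s) (p := p)
      refine ⟨some (entry s p r), ⟨h5, h6, fun z hz hiz => (h7 z hz hiz).1⟩, hseq ?_⟩
      refine WP.mono (WP.branch (T := 4 + (10 + 10)) (.reg hr8) (fun _ => ?_) fun h => absurd h (by omega)) (by decide)
        fun _ _ h => h
      refine WP.seq (WP.assign (v := r) (.congr (.sub (.reg hr8) (.lit (by omega)) (by omega)
        (by omega)) (by omega)) (WP.seq ((WP.output (hS.fst_val (p := p) (x := r) (by omega) hp (by norm_num) (by simp [h3])
          (by simp) hrk) ((WP.output (hS.snd_val (p := p) (x := r) (by omega) hp (by norm_num) (by simp [h3])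
          (by simp) hrk) rfl).mono (by decide) fun _ _ h => h)).mono (by decide) fun _ _ h => h)))
  obtain ⟨r, hr, hWP⟩ := hmain
  refine ⟨r, hr, hWP.answers ?_⟩
  have h1 := level_add_one_le y
  have hd : (0 : ℝ) < ((p - i : ℕ) : ℝ) := by exact_mod_cast (by omega : 0 < p - i)
  have h2 : lg (lg (y : ℝ)) ≤ lg (lg (2 * ((p - i : ℕ) : ℝ))) := by
    refine lg_mono (by linarith [one_le_lg (y : ℝ)]) (lg_mono ?_ ?_)
    · exact_mod_cast (by omega : 0 < y)
    · exact_mod_cast (by omega : y ≤ 2 * (p - i))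
  have h3 := lg_lg_two_mul_le hd
  have h4 := one_le_lg (lg ((p - i : ℕ) : ℝ))
  push_cast
  linarith

theorem Stored.succLen_spec (hS : Stored w mem s addr g S val) {m : ℕ} (hp : 1 ≤ p)
    (hp' : p ≤ s.length) (hm : m ≤ s.length) : ∃ r, IsFirstFrom (repeatsInto s p) Prod.snd m r ∧
      Answers w succLenProg mem p m (repeatWords r) (10000 * lg (lg (m : ℝ))) := by
  have hg := hS.lt_two_pow
  have hw := hS.four_lt
  set V₀ : ℕ → ℕ := fun r => if r = 0 then p else if r = 1 then m else 0 with hV₀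
  have hmain : ∃ r, IsFirstFrom (repeatsInto s p) Prod.snd m r ∧
      WP w mem succLenProg (1100 * (level m + 1)) (fun _ o => o = repeatWords r) V₀ [] := by
    obtain ⟨V₁, o₁, ⟨rfl, h0, h1, h2, h3, h4, hr⟩, hexec⟩ := hS.search_spec (o := [])
      (V := Function.update (Function.update V₀ 2 p) 6 m) hp hp' (c := 1) (y := m)
      (by norm_num) (by omega) (by simp) (by simp)
    have hseq : ∀ {P Q}, WP w mem P 30 Q V₁ [] →
        WP w mem (.seq (assign 2 (.reg 0)) (.seq (assign 6 (.reg 1)) (.seq (search 1) P)))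
          (1100 * (level m + 1)) Q V₀ [] := by
      intro P Q hP
      exact WP.mono (T := 2 + (2 + (1020 * (level m + 1) + 30))) (WP.seq (WP.assign (v := p)
        (.reg (by simp [hV₀])) (WP.seq (WP.assign (v := m) (.reg (by simp [hV₀]))
        (WP.seq ⟨V₁, [], hP, hexec⟩))))) (by omega) fun _ _ h => h
    by_cases hrk : V₁ 8 < (repeatList s p).length
    · obtain ⟨h5, h6, h7⟩ := entry_of_rank_length hr hrk
      refine ⟨some (entry s p (V₁ 8)), ⟨h5, h6, h7⟩, hseq ?_⟩
      refine WP.mono (WP.branch (T := 10 + 10) (.lt (.reg rfl) (.reg h4)) (fun _ => ?_)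
        fun h => absurd hrk (by simpa using h)) (by decide) fun _ _ h => h
      exact WP.seq ((WP.output (hS.fst_val hp hp' (by norm_num) h3 rfl hrk) ((WP.output
        (hS.snd_val hp hp' (by norm_num) h3 rfl hrk) rfl).mono (by decide) fun _ _ h => h)).mono
        (by decide) fun _ _ h => h)
    · refine ⟨none, snd_lt_of_rank_length hr hrk, hseq ?_⟩
      exact WP.mono (WP.branch (T := 4) (.lt (.reg rfl) (.reg h4))
        (fun h => absurd (by simpa using h) hrk) fun _ =>
        WP.seq (WP.output (.lit (by omega)) (WP.output (.lit (by omega)) rfl))) (by decide)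
        fun _ _ h => h
  obtain ⟨r, hr, hWP⟩ := hmain
  refine ⟨r, hr, hWP.answers ?_⟩
  have h1 := level_add_one_le m
  have h4 := one_le_lg (lg (m : ℝ))
  push_cast
  linarith

theorem Stored.phrase_spec (hS : Stored w mem s addr g S val) {i l u : ℕ} (hi : 1 ≤ i)
    (hil : i + l ≤ s.length + 1) (hu : 1 ≤ u) (hul : u ≤ l)
    (h0 : V 0 = i) (h1 : V 1 = l) (h2 : V 2 = i + u - 1) :
    ∃ t src, IsLZ77Phrase (substr s i l) u t ∧ IsRightmostSource (substr s i l) u t src ∧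
      1 ≤ t ∧ u + t ≤ l + 1 ∧
      WP w mem phraseProg (2200 * (level l + 1)) (fun V' o' => o' = o ∧ V' 0 = i ∧ V' 1 = l ∧
        V' 2 = i + u - 1 ∧ V' 15 = t ∧ V' 14 = src.getD 0) V o := by
  have hg := hS.lt_two_pow
  have hw := hS.four_lt
  set p := i + u - 1 with hp
  have hpn : p ≤ s.length := by omega
  have hk := length_repeatList_le (s := s) (p := p)
  have hpu : p - i + 1 = u := by omega
  have hlev := level_mono hul
  obtain ⟨V₁, o₁, ⟨rfl, h10, h11, h12, h13, h14, hr⟩, hexec⟩ := hS.search_spec (o := o)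
    (V := Function.update V 6 u) (p := p) (by omega) hpn (c := 0) (y := u)
    (by norm_num) (by omega) (by simp [h2]) (by simp)
  replace h10 : V₁ 0 = i := by simpa [h0] using h10
  replace h11 : V₁ 1 = l := by simpa [h1] using h11
  have hseq : ∀ {P Q}, WP w mem P (1020 * (level l + 1) + 100) Q V₁ o₁ →
      WP w mem (.seq (assign 6 (.reg 2 - .reg 0 + .lit 1)) (.seq (search 0) P))
        (2200 * (level l + 1)) Q V o₁ := by
    intro P Q hP
    exact WP.mono (T := 6 + (1020 * (level u + 1) + (1020 * (level l + 1) + 100)))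
      (WP.seq (WP.assign (v := u) (.congr (.add (.sub (.reg h2)
        (.reg h0) (by omega) (by omega)) (.lit (by omega)) (by omega)) hpu)
        (WP.seq ⟨V₁, _, hP, hexec⟩))) (by omega) fun _ _ h => h
  rcases hr8 : V₁ 8 with _ | r
  · rw [hr8, ← hpu] at hr
    obtain ⟨h3, h4⟩ := phrase_of_no_repeat hi hil hul
      (fst_lt_of_rank_distance_eq_zero (by omega) hr)
    refine ⟨1, none, h3, h4, le_rfl, by omega, hseq ?_⟩
    refine WP.mono (WP.branch (T := 4) (.reg hr8) (fun h => absurd rfl h) fun _ =>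
      WP.seq (WP.assign (.lit (by omega)) (WP.assign (.lit (by omega)) ?_))) (by simp [Expr.cost])
      fun _ _ h => h
    simp [h10, h11, h12]
  · rw [hr8, ← hpu] at hr
    obtain ⟨h3, h4, h5⟩ := entry_of_rank_distance (by omega) hr
    have hrk : r < (repeatList s p).length := hr.1
    obtain ⟨h3a, h3b, h3c, h3d, -⟩ := id h3
    set x := entry s p r with hx
    set V₂ := Function.update (Function.update (Function.update V₁ 8 r) 14 x.1) 15 x.2 with hV₂
    have e0 : V₂ 0 = i := by simp [hV₂, h10]
    have e1 : V₂ 1 = l := by simp [hV₂, h11]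
    have e2 : V₂ 2 = p := by simp [hV₂, h12]
    have e14 : V₂ 14 = x.1 := by simp [hV₂]
    have e15 : V₂ 15 = x.2 := by simp [hV₂]
    have hseq' : ∀ {P Q P'}, WP w mem P (1020 * (level l + 1) + 60) Q V₂ o₁ →
        WP w mem (branch (.reg 8) (.seq (assign 8 (.reg 8 - .lit 1)) (.seq (assign 14 (.ld (pairAddr 1 8)))
        (.seq (assign 15 (.ld (pairAddr 2 8))) P))) P') (1020 * (level l + 1) + 100) Q V₁ o₁ := by
      intro P Q P' hP
      refine WP.mono (WP.branch (T := 4 + (10 + (10 + (1020 * (level l + 1) + 60)))) (.reg hr8)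
        (fun _ => ?_) fun h => absurd h (by omega)) (by simp [Expr.cost]; omega) fun _ _ h => h
      exact WP.seq (WP.assign (v := r) (.congr (.sub (.reg hr8) (.lit (by omega)) (by omega)
        (by omega)) (by omega)) (WP.seq ((WP.assign (hS.fst_val (p := p) (x := r) (by omega) hpn (by norm_num)
          (by simp [h13]) (by simp) hrk) (WP.seq ((WP.assign (hS.snd_val (p := p) (x := r) (by omega) hpn
          (by norm_num) (by simp [h13]) (by simp) hrk) hP).mono (by decide) fun _ _ h => h))).mono
          (by decide) fun _ _ h => h)))
    have hcond : (Expr.bin .lt (.reg 0 + .reg 1) (.reg 2 + .reg 15)).Val w mem V₂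
        (if i + l < p + x.2 then 1 else 0) :=
      .lt (.add (.reg e0) (.reg e1) (by omega)) (.add (.reg e2) (.reg e15) (by omega))
    by_cases hlong : i + l < p + x.2
    · obtain ⟨V₃, o₃, ⟨rfl, h30, h31, h32, h33, h34, hr₃⟩, hexec₃⟩ := hS.search_spec (o := o₁)
        (V := Function.update V₂ 6 (l + 1 - u)) (p := p) (by omega) hpn (c := 1) (y := l + 1 - u)
        (by norm_num) (by omega) (by simp [e2]) (by simp)
      replace h30 : V₃ 0 = i := by simpa [e0] using h30
      replace h31 : V₃ 1 = l := by simpa [e1] using h31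
      have hlev' : level (l + 1 - u) ≤ level l := level_mono (by omega)
      -- The pair `x` covers the rest of the substring, so the second search cannot fail.
      have hrk₃ : V₃ 8 < (repeatList s p).length := by
        by_contra hc
        have := snd_lt_of_rank_length hr₃ hc x h3
        omega
      obtain ⟨h6, h7, h8⟩ := entry_of_rank_length hr₃ hrk₃
      obtain ⟨h9, h10⟩ := phrase_of_long_repeat hi hil hul h3 h4 (by omega) h6 h7 h8
      set z := entry s p (V₃ 8) with hz
      -- The staircase gives `x.1 ≤ z.1`; the subtraction of `i` then does not wrap.
      have hiz : i ≤ z.1 := by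
        have h11 := h10.1.1
        obtain ⟨h6a, h6b, h6c, h6d, -⟩ := id h6
        by_contra! hc
        rcases (h8 x h3 (by omega)).eq_or_lt with h | h
        · have : z.1 = x.1 := IsRightClosedRepeat.left_unique (t := x.2) (by rw [← h]; exact h6) h3
          omega
        · have := IsRightClosedRepeat.lt_of_lt h6 h3 h
          omega
      have hzp := h6.2.2.1
      refine ⟨l + 1 - u, some (z.1 - i + 1), h9, h10, by omega, by omega, hseq (hseq' ?_)⟩
      have hlm : (Expr.reg 0 + .reg 1 - .reg 2).Val w mem V₂ (l + 1 - u) :=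
        .congr (.sub (.add (.reg e0) (.reg e1) (by omega)) (.reg e2) (by omega) (by omega)) (by omega)
      have hlm₃ : ∀ v, (Expr.reg 0 + .reg 1 - .reg 2).Val w mem (Function.update V₃ 14 v) (l + 1 - u) :=
        fun v => .congr (.sub (.add (.reg (x := i) (by simp [h30])) (.reg (x := l) (by simp [h31]))
          (by omega)) (.reg (x := p) (by simp [h32])) (by omega) (by omega)) (by omega)
      refine WP.mono (T := (7 + (6 + (1020 * (level (l + 1 - u) + 1) + (10 + 6)) + 1)) + 6) (WP.seq
        (WP.branch hcond (fun _ => ?_) fun h => absurd hlong (by simpa using h))) (by omega)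
        fun _ _ h => h
      refine WP.seq (WP.assign hlm (WP.seq ⟨V₃, _, ?_, hexec₃⟩))
      refine WP.seq ((WP.assign (hS.fst_val (p := p) (by omega) hpn (by norm_num) h33 rfl hrk₃)
        (WP.assign (hlm₃ _) ?_)).mono (by decide) fun _ _ h => h)
      refine WP.assign (.add (.sub (.reg (x := z.1) (by simp [hz])) (.reg (x := i) (by simp [h30])) hiz
        (by omega)) (.lit (by omega)) (by omega)) ?_
      simp [h30, h31, h32]
    · obtain ⟨h9, h10⟩ := phrase_of_repeat hi hil h3 h4 (fun z hz hiz => (h5 z hz hiz).2) (by omega)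
      refine ⟨x.2, some (x.1 - i + 1), h9, h10, by omega, by omega, hseq (hseq' ?_)⟩
      refine WP.mono (T := 9 + 6) (WP.seq (WP.mono (WP.branch (T := 1) hcond
        (fun h => absurd (by simpa using h) hlong) fun _ => WP.skip ?_) (by decide) fun _ _ h => h))
        (by omega) fun _ _ h => h
      refine WP.assign (.add (.sub (.reg e14) (.reg e0) h4 (by omega)) (.lit (by omega)) (by omega)) ?_
      simp [e0, e1, e2, e15]

/-- Induction on the length that remains to be parsed. Non-emptiness of `fs` is recorded so that the
additive constant can be charged to a phrase. -/
theorem Stored.parse_loop_spec (hS : Stored w mem s addr g S val) {i l : ℕ} (hi : 1 ≤ i)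
    (hil : i + l ≤ s.length + 1) : ∀ (d u : ℕ), d = l + 1 - u → 1 ≤ u → u ≤ l + 1 →
      ∀ V o, V 0 = i → V 1 = l → V 2 = i + u - 1 →
        ∃ fs, IsRightmostLZ77From (substr s i l) u fs ∧ (u ≤ l → fs ≠ []) ∧
          WP w mem (loopWhile (.bin .lt (.reg 2) (.reg 0 + .reg 1))
            (.seq phraseProg (.seq (output (.reg 2 - .reg 0 + .lit 1)) (.seq (output (.reg 15))
              (.seq (output (.reg 14)) (assign 2 (.reg 2 + .reg 15)))))))
            (2230 * (level l + 1) * fs.length + 6)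
            (fun _ o' => o' = o ++ fs.flatMap Phrase.words) V o := by
  have hg := hS.lt_two_pow
  have hw := hS.four_lt
  intro d
  induction d using Nat.strong_induction_on with
  | _ d ih =>
    rintro u rfl hu hul V o h0 h1 h2
    have hcond : (Expr.bin .lt (.reg 2) (.reg 0 + .reg 1)).Val w mem V
        (if i + u - 1 < i + l then 1 else 0) := .lt (.reg h2) (.add (.reg h0) (.reg h1) (by omega))
    rcases hul.eq_or_lt with rfl | hul'
    · refine ⟨[], by rw [IsRightmostLZ77From, length_substr hi hil], by omega, ?_⟩
      rw [if_neg (by omega)] at hcond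
      exact (WP.while_done hcond (by simp)).mono (by simp [Expr.cost]) fun _ _ h => h
    · rw [if_pos (by omega)] at hcond
      obtain ⟨t, src, ht, hsrc, h1t, hut, V₁, o₁, ⟨rfl, h10, h11, h12, h13, h14⟩, hexec⟩ :=
        hS.phrase_spec (o := o) hi hil hu (by omega) h0 h1 h2
      let f : Phrase := ⟨u, t, src⟩
      obtain ⟨fs, hfs, -, hWP⟩ := ih (l + 1 - (u + t)) (by omega) (u + t) rfl (by omega) hut
        (Function.update V₁ 2 (i + (u + t) - 1)) (o₁ ++ [u] ++ [t] ++ [src.getD 0]) (by simp [h10])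
        (by simp [h11]) (by simp)
      refine ⟨f :: fs, ⟨rfl, ht, hsrc, hfs⟩, fun _ => List.cons_ne_nil _ _, ?_⟩
      have hcost : (Expr.bin .lt (.reg 2) (.reg 0 + .reg 1)).cost ≤ 7 := by decide
      refine (WP.while_step (T := 2200 * (level l + 1) + (6 + (2 + (2 + 4))))
        (T' := 2230 * (level l + 1) * fs.length + 6) hcond one_ne_zero
        (WP.seq ⟨V₁, o₁, ?_, hexec⟩)).mono ?_ fun _ _ h => h
      · refine WP.seq (WP.output (v := u) (.congr (.add (.sub (.reg h12) (.reg h10) (by omega) (by omega))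
          (.lit (by omega)) (by omega)) (by omega)) (WP.seq (WP.output (.reg h13) (WP.seq
          (WP.output (.reg h14) (WP.assign (v := i + (u + t) - 1) (.congr (.add (.reg h12) (.reg h13)
          (by omega)) (by omega)) (hWP.mono le_rfl fun _ o' h => ?_)))))))
        rw [h]
        simp [f, Phrase.words]
      · rw [List.length_cons, Nat.mul_add_one (2230 * (level l + 1))]
        omega

theorem Stored.parse_spec (hS : Stored w mem s addr g S val) {i l : ℕ} (hi : 1 ≤ i) (hl : 1 ≤ l)
    (hil : i + l ≤ s.length + 1) : ∃ fs, IsRightmostLZ77 (substr s i l) fs ∧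
      Answers w parseProg mem i l (fs.flatMap Phrase.words) (10000 * (fs.length * lg (lg (l : ℝ)))) := by
  obtain ⟨fs, h1, h2, h3⟩ := hS.parse_loop_spec hi hil l 1 (by omega) le_rfl (by omega)
    (Function.update (fun r => if r = 0 then i else if r = 1 then l else 0) 2 i) [] (by simp) (by simp)
    (by simp)
  refine ⟨fs, h1, (WP.mono (T := 2 + (2230 * (level l + 1) * fs.length + 6)) (WP.seq (WP.assign
    (.reg (x := i) (by simp)) h3)) le_rfl
    fun _ _ h => by simpa using h).answers ?_⟩
  have h4 : (1 : ℝ) ≤ fs.length := by exact_mod_cast List.length_pos_of_ne_nil (h2 hl)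
  have h5 := level_add_one_le l
  have h6 := one_le_lg (lg (l : ℝ))
  push_cast
  nlinarith

end Queries
/-! ## The memory -/

section Segments
variable {L A B mem : List ℕ} {o i k : ℕ}

theorem prefix_drop_append_left (h : L <+: B.drop o) : L <+: (A ++ B).drop (A.length + o) := by
  rwa [List.drop_append, List.drop_eq_nil_of_le (by omega), List.nil_append,
    Nat.add_sub_cancel_left]

theorem prefix_drop_append_right (h : L <+: A.drop o) : L <+: (A ++ B).drop o := by
  rw [List.drop_append]
  exact h.trans (List.prefix_append _ _)

theorem getElem?_of_prefix_drop {v : ℕ} (h : L <+: mem.drop o) (hv : L[i]? = some v) :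
    mem[o + i]? = some v := by
  obtain ⟨t, ht⟩ := h
  rw [← List.getElem?_drop, ← ht, List.getElem?_append_left (lt_length_of_getElem? hv), hv]

theorem length_flatMap_range (f : ℕ → List ℕ) (m : ℕ) :
    ((List.range m).flatMap f).length = ∑ j ∈ range m, (f j).length := by
  induction m with
  | zero => simp
  | succ m ih => rw [List.range_succ, List.flatMap_append, List.length_append, ih, sum_range_succ]; simp

theorem prefix_drop_flatMap_range (f : ℕ → List ℕ) {m : ℕ} (hi : i < m) :
    f i <+: ((List.range m).flatMap f).drop (∑ j ∈ range i, (f j).length) := by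
  induction m with
  | zero => omega
  | succ m ih =>
    rw [List.range_succ, List.flatMap_append]
    rcases (Nat.lt_succ_iff.1 hi).eq_or_lt with rfl | h
    · rw [← length_flatMap_range, ← Nat.add_zero (List.length _)]
      refine prefix_drop_append_left ?_
      simp
    · exact prefix_drop_append_right (ih h)

theorem getElem?_flatMap_range (f : ℕ → List ℕ) {c m v : ℕ} (hc : ∀ j, (f j).length = c)
    (hi : i < m) (hv : (f i)[k]? = some v) : ((List.range m).flatMap f)[c * i + k]? = some v := by
  have h := getElem?_of_prefix_drop (prefix_drop_flatMap_range f hi) hv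
  simp only [hc, sum_const, card_range, smul_eq_mul] at h
  rwa [mul_comm]

end Segments

section Keys
variable {M t e v : ℕ}

/-- `trieKey` is positional notation in base `M`, so trie number, depth and prefix can be recovered
and different tries do not share keys. -/
theorem trieKey_mod (hv : v < M) : trieKey M t e v % M = v := by
  rw [trieKey, Nat.mul_add_mod_self_right, Nat.mod_eq_of_lt hv]

theorem trieKey_div (hv : v < M) : trieKey M t e v / M = t * M + e := by
  rw [trieKey, mul_comm, Nat.mul_add_div (by omega), Nat.div_eq_of_lt hv, add_zero]

theorem trieKey_div_mod (he : e < M) (hv : v < M) : trieKey M t e v / M % M = e := by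
  rw [trieKey_div hv, Nat.mul_add_mod_self_right, Nat.mod_eq_of_lt he]

theorem trieKey_div_div (he : e < M) (hv : v < M) : trieKey M t e v / M / M = t := by
  rw [trieKey_div hv, mul_comm, Nat.mul_add_div (by omega), Nat.div_eq_of_lt he, add_zero]

theorem trieKey_lt (ht : t < 2 * M) (he : e < M) (hv : v < M) : trieKey M t e v < 2 * M ^ 3 := by
  have h1 : t * M + e + 1 ≤ 2 * M * M := by
    have := Nat.mul_le_mul_right M (Nat.succ_le_of_lt ht)
    rw [Nat.succ_mul] at this
    omega
  have h2 := Nat.mul_le_mul_right M h1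
  have h3 : 2 * M * M * M = 2 * M ^ 3 := by ring
  rw [Nat.add_one_mul, h3] at h2
  unfold trieKey
  omega

end Keys

section Memory
variable {α : Type*} {s : List α}

open Classical in
/-- The keys of the entries of all tries. -/
noncomputable def allKeys (s : List α) (g : ℕ) : Finset ℕ :=
  (Icc 1 s.length).biUnion fun p => (range 2).biUnion fun c =>
    (trieEntries (trieKeys s p c) (repeatList s p).length g).image fun z =>
      trieKey (2 ^ g) (p + p + c) z.1 z.2

/-- The value that belongs to a key. -/
noncomputable def keyVal (s : List α) (g z : ℕ) : ℕ :=
  trieVal (trieKeys s (z / 2 ^ g / 2 ^ g / 2) (z / 2 ^ g / 2 ^ g % 2))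
    (repeatList s (z / 2 ^ g / 2 ^ g / 2)).length (z / 2 ^ g % 2 ^ g) (z % 2 ^ g)

/-- The block of memory cells for the list of `p`. -/
noncomputable def listBlock (s : List α) (p : ℕ) : List ℕ :=
  (repeatList s p).length :: (List.range (repeatList s p).length).flatMap fun x =>
    [(entry s p x).1, (entry s p x).2]

theorem listBlock_eq (s : List α) (p : ℕ) : listBlock s p =
    (repeatList s p).length :: (repeatList s p).flatMap fun x => [x.1, x.2] := by
  have h : repeatList s p = (List.range (repeatList s p).length).map (entry s p) := by
    refine List.ext_getElem (by simp) fun x h1 h2 => ?_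
    rw [List.getElem_map, List.getElem_range, entry_eq h1]
  rw [listBlock]
  congr 1
  conv_rhs => rw [h]
  rw [List.flatMap_map]

theorem length_listBlock (s : List α) (p : ℕ) :
    (listBlock s p).length = 1 + 2 * (repeatList s p).length := by
  rw [listBlock, List.length_cons, length_flatMap_range]
  simp [mul_comm, add_comm]

theorem getElem?_listBlock_fst {p x : ℕ} (hx : x < (repeatList s p).length) :
    (listBlock s p)[1 + (x + x)]? = some (entry s p x).1 := by
  rw [listBlock, add_comm, List.getElem?_cons_succ, ← two_mul]
  exact getElem?_flatMap_range (c := 2) (k := 0) _ (fun _ => rfl) hx rfl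

theorem getElem?_listBlock_snd {p x : ℕ} (hx : x < (repeatList s p).length) :
    (listBlock s p)[2 + (x + x)]? = some (entry s p x).2 := by
  rw [listBlock, show 2 + (x + x) = 2 * x + 1 + 1 by ring, List.getElem?_cons_succ]
  exact getElem?_flatMap_range (c := 2) (k := 1) _ (fun _ => rfl) hx rfl

theorem le_of_mem_listBlock {p v : ℕ} (hv : v ∈ listBlock s p) : v ≤ s.length := by
  rw [listBlock_eq, List.mem_cons, List.mem_flatMap] at hv
  rcases hv with rfl | ⟨x, hx, hv⟩
  · exact length_repeatList_le
  · obtain ⟨h1, h2, h3, h4, -⟩ := mem_repeatList.1 hx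
    simp only [List.mem_cons, List.not_mem_nil, or_false] at hv
    omega

variable {g : ℕ}

theorem two_mul_le_two_pow (hg : 1 ≤ g) : 2 * g ≤ 2 ^ g := by
  obtain ⟨g', rfl⟩ := Nat.exists_eq_add_of_le' hg
  have := Nat.lt_two_pow_self (n := g')
  rw [pow_succ]
  omega

theorem mem_allKeys (hg : 1 ≤ g) (hn : s.length < 2 ^ g) {p c e v : ℕ} (hp : 1 ≤ p)
    (hp' : p ≤ s.length) (hc : c < 2) (he : e < 2 * g) (hv : v < 2 ^ g) :
    trieKey (2 ^ g) (p + p + c) e v ∈ allKeys s g ↔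
      Present (trieKeys s p c) (repeatList s p).length e v := by
  classical
  have hgg := two_mul_le_two_pow hg
  rw [← mem_trieEntries he]
  simp only [allKeys, mem_biUnion, mem_Icc, Finset.mem_range, mem_image, Prod.exists]
  constructor
  · rintro ⟨p', hp', c', hc', e', v', hz, h⟩
    have h1 := fst_lt_of_mem_trieEntries hg (fun x hx => (trieKeys_le hx).trans_lt hn) hz
    have he' : e' < 2 ^ g := by have := h1.1; omega
    have h2 := congrArg (· / 2 ^ g / 2 ^ g) h
    have h3 := congrArg (· / 2 ^ g % 2 ^ g) h
    have h4 := congrArg (· % 2 ^ g) h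
    simp only [trieKey_div_div he' h1.2, trieKey_div_mod he' h1.2, trieKey_mod h1.2,
      trieKey_div_div (he.trans_le hgg) hv, trieKey_div_mod (he.trans_le hgg) hv,
      trieKey_mod hv] at h2 h3 h4
    obtain rfl : p' = p := by omega
    obtain rfl : c' = c := by omega
    rwa [← h3, ← h4]
  · exact fun h => ⟨p, ⟨hp, hp'⟩, c, hc, e, v, h, rfl⟩

theorem keyVal_trieKey (hg : 1 ≤ g) {p c e v : ℕ} (hc : c < 2) (he : e < 2 * g) (hv : v < 2 ^ g) :
    keyVal s g (trieKey (2 ^ g) (p + p + c) e v) =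
      trieVal (trieKeys s p c) (repeatList s p).length e v := by
  have he' := he.trans_le (two_mul_le_two_pow hg)
  rw [keyVal, trieKey_div_div he' hv, trieKey_div_mod he' hv, trieKey_mod hv,
    show (p + p + c) / 2 = p by omega, show (p + p + c) % 2 = c by omega]

theorem keyVal_le (s : List α) (g z : ℕ) : keyVal s g z ≤ s.length :=
  (repBelow_le _ _ _).trans length_repeatList_le

theorem lt_of_mem_allKeys (hg : 1 ≤ g) (hn : s.length < 2 ^ g) {z : ℕ} (hz : z ∈ allKeys s g) :
    z < 2 * (2 ^ g) ^ 3 := by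
  classical
  have hgg := two_mul_le_two_pow hg
  simp only [allKeys, mem_biUnion, mem_Icc, Finset.mem_range, mem_image, Prod.exists] at hz
  obtain ⟨p, hp, c, hc, e, v, hz, rfl⟩ := hz
  have h1 := fst_lt_of_mem_trieEntries hg (fun x hx => (trieKeys_le hx).trans_lt hn) hz
  exact trieKey_lt (by omega) (h1.1.trans_le hgg) h1.2

theorem sum_length_repeatList_le (s : List α) :
    ∑ p ∈ Icc 1 s.length, (repeatList s p).length ≤ 2 * (s.length * Nat.log 2 s.length) := by
  simp only [length_repeatList]
  exact sum_card_repeatsFinset_le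

theorem card_allKeys_le (hg : g = Nat.log 2 s.length + 1) : #(allKeys s g) ≤ 16 * (s.length * g) := by
  classical
  have hn : s.length < 2 ^ g := by rw [hg]; exact Nat.lt_pow_succ_log_self (by norm_num) _
  calc #(allKeys s g) ≤ ∑ p ∈ Icc 1 s.length, 2 * ((repeatList s p).length + 6 * g) := by
        refine card_biUnion_le.trans (sum_le_sum fun p _ => card_biUnion_le.trans ?_)
        refine (sum_le_card_nsmul _ _ ((repeatList s p).length + 6 * g) fun c _ => ?_).trans (by simp)
        exact card_image_le.trans (card_trieEntries_le (by omega) (fun _ _ h h' => trieKeys_lt h h')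
          fun x hx => (trieKeys_le hx).trans_lt hn)
    _ = 2 * ∑ p ∈ Icc 1 s.length, (repeatList s p).length + 12 * (s.length * g) := by
        simp only [mul_add, sum_add_distrib, mul_sum, sum_const, Nat.card_Icc, smul_eq_mul]
        ring_nf
        simp [mul_comm]
    _ ≤ 2 * (2 * (s.length * Nat.log 2 s.length)) + 12 * (s.length * g) := by
        gcongr
        exact sum_length_repeatList_le s
    _ ≤ _ := by
        have : s.length * Nat.log 2 s.length ≤ s.length * g := Nat.mul_le_mul_left _ (by omega)
        omega

/-- Layout: cell `0` points to the header, cells `1` to `n` to the lists; then follow the six header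
words, `m` first-level rows of three words, `T` table cells of two words, and the list blocks. Since
`16 * g ≤ w`, sixteenth powers of `M = 2 ^ g` fit into a word range, which bounds all addresses and
products. -/
theorem exists_memory (s : List α) (hs : 1 ≤ s.length) {w : ℕ} (hg : g = Nat.log 2 s.length + 1)
    (hw : 16 * g ≤ w) : ∃ (mem : List ℕ) (addr : ℕ → ℕ),
      (∀ v ∈ mem, v < 2 ^ w) ∧ mem.length ≤ 290 * (s.length * g) ∧
      (∀ p, 1 ≤ p → p ≤ s.length → listBlock s p <+: mem.drop (addr p)) ∧
      Stored w mem s addr g (allKeys s g) (keyVal s g) := by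
  classical
  set n := s.length with hn
  have hg1 : 1 ≤ g := by omega
  have hng : n < 2 ^ g := by rw [hg]; exact Nat.lt_pow_succ_log_self (by norm_num) _
  have hggM := two_mul_le_two_pow hg1
  set M := 2 ^ g with hM
  have hM2 : 2 ≤ M := by omega
  have hMw : M ^ 16 ≤ 2 ^ w := by
    rw [hM, ← pow_mul]
    exact Nat.pow_le_pow_right (by norm_num) (by omega)
  set K := 2 * M ^ 3 with hK
  have hK4 : K ≤ M ^ 4 := by rw [hK, pow_succ' M 3]; exact Nat.mul_le_mul_right _ hM2
  have hKpos : K ≠ 0 := by positivity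
  -- Bertrand's postulate: a prime above all keys, yet small enough for products with keys to fit
  -- into a word.
  obtain ⟨P, hP, hKP, hPK⟩ := Nat.exists_prime_lt_and_le_two_mul K hKpos
  have hP5 : P ≤ M ^ 5 := by
    rw [pow_succ' M 4]
    exact hPK.trans (Nat.mul_le_mul hM2 hK4)
  have hpow : ∀ a b : ℕ, a < b → M ^ a < M ^ b := fun a b h => Nat.pow_lt_pow_right (by omega) h
  set S := allKeys s g with hS
  have hSK : ∀ z ∈ S, z < K := fun z hz => lt_of_mem_allKeys hg1 hng hz
  obtain ⟨a, off, sz, mul, T, haP, hT, hparam, hposT, hinj⟩ :=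
    exists_perfect_hash hP fun z hz => (hSK z hz).trans hKP
  set m := #S + 1 with hm
  have hcard : #S ≤ 16 * (n * g) := card_allKeys_le hg
  set pos := hashPos P m a off sz mul with hpos
  let cell : ℕ → List ℕ := fun c =>
    -- Empty cells hold `P`, which exceeds every possible query key and so never matches.
    if h : ∃ z ∈ S, pos z = c then [h.choose, keyVal s g h.choose] else [P, 0]
  let row : ℕ → List ℕ := fun h => [off h, sz h, mul h]
  have hcell_len : ∀ c, (cell c).length = 2 := fun c => by simp only [cell]; split_ifs <;> rfl
  have hrow_len : ∀ h, (row h).length = 3 := fun h => rfl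
  set b₁ := n + 7 with hb₁
  set b₂ := b₁ + 3 * m with hb₂
  set b₃ := b₂ + 2 * T with hb₃
  let addr : ℕ → ℕ := fun p => b₃ + ∑ j ∈ range (p - 1), (listBlock s (j + 1)).length
  set A₁ : List ℕ := (n + 1) :: (List.range n).map fun j => addr (j + 1) with hA₁
  set A₂ : List ℕ := [M, P, a, m, b₁, b₂] with hA₂
  set A₃ : List ℕ := (List.range m).flatMap row with hA₃
  set A₄ : List ℕ := (List.range T).flatMap cell with hA₄
  set A₅ : List ℕ := (List.range n).flatMap fun j => listBlock s (j + 1) with hA₅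
  have l₁ : A₁.length = n + 1 := by simp [hA₁]
  have l₂ : A₂.length = 6 := rfl
  have l₃ : A₃.length = 3 * m := by
    rw [hA₃, length_flatMap_range]; simp [hrow_len, mul_comm]
  have l₄ : A₄.length = 2 * T := by
    rw [hA₄, length_flatMap_range]; simp [hcell_len, mul_comm]
  have l₅' : A₅.length = ∑ j ∈ range n, (listBlock s (j + 1)).length := length_flatMap_range _ _
  have l₅ : A₅.length ≤ n + 4 * (n * g) := by
    have h1 : ∑ j ∈ range n, (repeatList s (j + 1)).length ≤ 2 * (n * Nat.log 2 n) := by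
      refine le_trans (le_of_eq ?_) (sum_length_repeatList_le s)
      rw [range_eq_Ico, sum_Ico_add' (fun p => (repeatList s p).length) 0 n 1]
      rfl
    have h2 : n * Nat.log 2 n ≤ n * g := Nat.mul_le_mul_left _ (by omega)
    rw [l₅']
    simp only [length_listBlock, sum_add_distrib, ← mul_sum, sum_const, card_range, smul_eq_mul]
    omega
  set mem := A₁ ++ (A₂ ++ (A₃ ++ (A₄ ++ A₅))) with hmem
  have hlen : mem.length = n + 1 + (6 + (3 * m + (2 * T + A₅.length))) := by
    simp only [hmem, List.length_append, l₁, l₂, l₃, l₄]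
  have hng1 : n ≤ n * g := Nat.le_mul_of_pos_right _ hg1
  -- The parts add up to at most `276 n g + 2 n + 12`, and `1 ≤ n ≤ n g`.
  have hlen' : mem.length ≤ 290 * (n * g) := by omega
  have hng2 : n * g ≤ M ^ 2 := by rw [sq]; exact Nat.mul_le_mul hng.le (by omega)
  have hlenM : mem.length < M ^ 12 := by
    have h1 : 290 ≤ M ^ 9 := le_trans (by norm_num) (Nat.pow_le_pow_left hM2 9)
    calc _ ≤ M ^ 9 * M ^ 2 := hlen'.trans (Nat.mul_le_mul h1 hng2)
      _ = M ^ 11 := by ring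
      _ < _ := hpow 11 12 (by norm_num)
  have hlenw : mem.length < 2 ^ w := hlenM.trans ((hpow 12 16 (by norm_num)).trans_le hMw)
  have hPw : P < 2 ^ w := (hP5.trans_lt (hpow 5 16 (by norm_num))).trans_le hMw
  have hMw' : M < 2 ^ w := by
    refine lt_of_lt_of_le ?_ hMw
    simpa using hpow 1 16 (by norm_num)
  have hget₁ : ∀ x v, A₁[x]? = some v → mem[x]? = some v := fun x v h => by
    rw [hmem, List.getElem?_append_left (lt_length_of_getElem? h), h]
  have hget₂ : ∀ x v, A₂[x]? = some v → mem[n + 1 + x]? = some v := fun x v h => by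
    rw [hmem, List.getElem?_append_right (by omega), l₁, Nat.add_sub_cancel_left,
      List.getElem?_append_left (lt_length_of_getElem? h), h]
  have hget₃ : ∀ x v, A₃[x]? = some v → mem[b₁ + x]? = some v := fun x v h => by
    rw [hmem, List.getElem?_append_right (by omega), List.getElem?_append_right (by omega), l₁, l₂,
      show b₁ + x - (n + 1) - 6 = x by omega, List.getElem?_append_left (lt_length_of_getElem? h), h]
  have hget₄ : ∀ x v, A₄[x]? = some v → mem[b₂ + x]? = some v := fun x v h => by
    rw [hmem, List.getElem?_append_right (by omega), List.getElem?_append_right (by omega),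
      List.getElem?_append_right (by omega), l₁, l₂, l₃,
      show b₂ + x - (n + 1) - 6 - 3 * m = x by omega,
      List.getElem?_append_left (lt_length_of_getElem? h), h]
  have hblock : ∀ p, 1 ≤ p → p ≤ n → listBlock s p <+: mem.drop (addr p) := by
    intro p hp hp'
    have h1 := prefix_drop_flatMap_range (fun j => listBlock s (j + 1)) (i := p - 1) (m := n) (by omega)
    rw [Nat.sub_add_cancel hp] at h1
    have h2 := prefix_drop_append_left (A := A₁) (prefix_drop_append_left (A := A₂)
      (prefix_drop_append_left (A := A₃) (prefix_drop_append_left (A := A₄) h1)))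
    rw [l₁, l₂, l₃, l₄] at h2
    convert h2 using 2
    simp only [addr]
    omega
  have haddr : ∀ p, 1 ≤ p → p ≤ n → addr p < mem.length := by
    intro p hp hp'
    have h1 := (hblock p hp hp').length_le
    rw [length_listBlock, List.length_drop] at h1
    omega
  refine ⟨mem, addr, ?_, hlen', hblock, ?_⟩
  · have hcells : ∀ c, ∀ v ∈ cell c, v < 2 ^ w := by
      intro c v hv
      by_cases h : ∃ z ∈ S, pos z = c
      · simp only [cell, dif_pos h, List.mem_cons, List.not_mem_nil, or_false] at hv
        rcases hv with rfl | rfl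
        · exact (hSK _ h.choose_spec.1).trans (hKP.trans hPw)
        · exact (keyVal_le s g _).trans_lt (hng.trans hMw')
      · simp only [cell, dif_neg h, List.mem_cons, List.not_mem_nil, or_false] at hv
        rcases hv with rfl | rfl
        · exact hPw
        · positivity
    intro v hv
    simp only [hmem, List.mem_append] at hv
    rcases hv with hv | hv | hv | hv | hv
    · simp only [hA₁, List.mem_cons, List.mem_map, List.mem_range] at hv
      rcases hv with rfl | ⟨j, hj, rfl⟩
      · omega
      · exact (haddr _ (by omega) (by omega)).trans hlenw
    · simp only [hA₂, List.mem_cons, List.not_mem_nil, or_false] at hv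
      omega
    · obtain ⟨h, hh, hv⟩ := List.mem_flatMap.1 hv
      obtain ⟨h1, h2, h3⟩ := hparam h (List.mem_range.1 hh)
      simp only [row, List.mem_cons, List.not_mem_nil, or_false] at hv
      omega
    · obtain ⟨c, -, hv⟩ := List.mem_flatMap.1 hv
      exact hcells c v hv
    · obtain ⟨j, -, hv⟩ := List.mem_flatMap.1 hv
      exact (le_of_mem_listBlock hv).trans_lt (hng.trans hMw')
  · refine ⟨hlenw.le, hg1, hng, ?_, ?_, ?_, ?_, ?_, ?_, ?_, ?_, ?_⟩
    · exact (hK4.trans (hpow 4 16 (by norm_num)).le).trans hMw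
    · refine lt_of_lt_of_le ?_ hMw
      calc 4 * M ≤ M ^ 2 * M := Nat.mul_le_mul_right _ (Nat.pow_le_pow_left hM2 2)
        _ = M ^ 3 := by ring
        _ < M ^ 16 := hpow 3 16 (by norm_num)
    · intro p hp hp'
      refine hget₁ _ _ ?_
      obtain ⟨p, rfl⟩ := Nat.exists_eq_add_of_le' hp
      rw [hA₁, List.getElem?_cons_succ, List.getElem?_map, List.getElem?_range (by omega)]
      rfl
    · exact fun p hp hp' => getElem?_of_prefix_drop (hblock p hp hp') (i := 0) rfl
    · intro p hp hp' x hx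
      rw [add_assoc]
      exact getElem?_of_prefix_drop (hblock p hp hp') (getElem?_listBlock_fst hx)
    · intro p hp hp' x hx
      rw [add_assoc]
      exact getElem?_of_prefix_drop (hblock p hp hp') (getElem?_listBlock_snd hx)
    · have hmulw : ∀ b < P, ∀ z < K, b * z < 2 ^ w := by
        intro b hb z hz
        calc b * z ≤ M ^ 5 * M ^ 4 := Nat.mul_le_mul (hb.le.trans hP5) (hz.le.trans hK4)
          _ = M ^ 9 := by ring
          _ < M ^ 16 := hpow 9 16 (by norm_num)
          _ ≤ _ := hMw
      refine ⟨n + 1, P, a, m, b₁, b₂, hget₁ 0 _ rfl, hget₂ 0 _ rfl, hget₂ 1 _ rfl, hget₂ 2 _ rfl,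
        hget₂ 3 _ rfl, hget₂ 4 _ rfl, hget₂ 5 _ rfl, fun z hz => ⟨hmulw a haP z hz, ?_⟩⟩
      set h := hash P m a z with hh
      have hhm : h < m := Nat.mod_lt _ (by omega)
      have hc0 : off h + hash P (sz h) (mul h) z < T := hposT z
      have hposz : pos z = off h + hash P (sz h) (mul h) z := rfl
      rw [← hposz] at hc0
      have hrow : ∀ k v, (row h)[k]? = some v → mem[b₁ + 3 * h + k]? = some v := fun k v hv => by
        rw [add_assoc]
        exact hget₃ _ _ (getElem?_flatMap_range row hrow_len hhm hv)
      have hcell : ∀ k v, (cell (pos z))[k]? = some v → mem[b₂ + 2 * pos z + k]? = some v :=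
        fun k v hv => by
          rw [add_assoc]
          exact hget₄ _ _ (getElem?_flatMap_range cell hcell_len hc0 hv)
      refine ⟨off h, sz h, mul h, ?_⟩
      by_cases hex : ∃ z' ∈ S, pos z' = pos z
      · obtain ⟨hc1, hc2⟩ := hex.choose_spec
        have hcz : cell (pos z) = [hex.choose, keyVal s g hex.choose] := dif_pos hex
        rw [hcz] at hcell
        refine ⟨hex.choose, keyVal s g hex.choose, hmulw _ (hparam h hhm).2.2 z hz, hrow 0 _ rfl,
          hrow 1 _ rfl, hrow 2 _ rfl, hcell 0 _ rfl, hcell 1 _ rfl, ⟨fun he => he ▸ hc1, fun hzS => ?_⟩,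
          fun hzS => ?_⟩
        · exact hinj hc1 hzS hc2
        · rw [hinj hc1 hzS hc2]
      · have hzS : z ∉ S := fun hzS => hex ⟨z, hzS, rfl⟩
        have hcz : cell (pos z) = [P, 0] := dif_neg hex
        rw [hcz] at hcell
        exact ⟨P, 0, hmulw _ (hparam h hhm).2.2 z hz, hrow 0 _ rfl, hrow 1 _ rfl, hrow 2 _ rfl,
          hcell 0 _ rfl, hcell 1 _ rfl, ⟨fun he => absurd (lt_of_eq_of_lt he hz) hKP.not_gt, fun h => absurd h hzS⟩,
          fun h => absurd h hzS⟩
    · exact fun p hp hp' c hc e he v hv => mem_allKeys hg1 hng hp hp' hc he hv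
    · exact fun p hp hp' c hc e he v hv _ => keyVal_trieKey hg1 hc he hv

end Memory
end RightmostLZ

/-! ### Assembly of the theorem. -/

open RightmostLZ
theorem mainTheorem6 :
    ∃ (parse succPos succLen : Prog) (c C : ℝ), ∀ (α : Type*) (s : List α) (w : ℕ),
      c * lg s.length ≤ w →
      ∃ mem : List ℕ,
        -- the structure takes `O(n log n)` words of `w` bits
        (∀ v ∈ mem, v < 2 ^ w) ∧
        (mem.length : ℝ) ≤ C * (s.length * lg s.length) ∧
        -- it stores, for each `p`, the right closed repeats whose next occurrence is at `p`
        StoresRepeats s mem ∧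
        -- the list of each `p` is searchable by the position `q`, in time `O(log log (p - i))`
        (∀ p i : ℕ, 1 ≤ i → i < p → p ≤ s.length →
          ∃ r, IsFirstFrom (repeatsInto s p) Prod.fst i r ∧
            Answers w succPos mem p i (repeatWords r) (C * lg (lg ((p - i : ℕ) : ℝ)))) ∧
        -- and by the length `t`, in time `O(log log m)`
        (∀ p m : ℕ, 1 ≤ p → p ≤ s.length → 1 ≤ m → m ≤ s.length →
          ∃ r, IsFirstFrom (repeatsInto s p) Prod.snd m r ∧
            Answers w succLen mem p m (repeatWords r) (C * lg (lg (m : ℝ)))) ∧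
        -- the rightmost LZ77 parsing of any `s[i .. i + ℓ)`, in time `O(z log log ℓ)`
        (∀ i ℓ : ℕ, 1 ≤ i → 1 ≤ ℓ → i + ℓ ≤ s.length + 1 →
          ∃ fs : List Phrase, IsRightmostLZ77 (substr s i ℓ) fs ∧
            Answers w parse mem i ℓ (fs.flatMap Phrase.words)
              (C * (fs.length * lg (lg (ℓ : ℝ))))) := by
  -- The constant `32` comes from `16 * g ≤ w` and `g ≤ 2 lg n`; `10000` covers the three running
  -- times and the space bound `580 n lg n`.
  refine ⟨parseProg, succPosProg, succLenProg, 32, 10000, fun α s w hw => ?_⟩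
  rcases Nat.eq_zero_or_pos s.length with hs | hs
  · refine ⟨[], by simp, by simp [hs], fun p h1 h2 => by omega, fun p i h1 h2 h3 => by omega,
      fun p m h1 h2 h3 => by omega, fun i l h1 h2 h3 => by omega⟩
  · set g := Nat.log 2 s.length + 1 with hg
    have hlg := natLog_add_one_le s.length
    rw [← hg] at hlg
    have hw' : 16 * g ≤ w := by
      have : ((16 * g : ℕ) : ℝ) ≤ w := by push_cast; linarith
      exact_mod_cast this
    obtain ⟨mem, addr, h1, h2, h3, h4⟩ := exists_memory s hs hg hw'
    refine ⟨mem, h1, ?_, fun p hp hp' => ?_, fun p i hi hip hp => h4.succPos_spec hi hip hp,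
      fun p m hp hp' _ hm => h4.succLen_spec hp hp' hm, fun i l hi hl hil => h4.parse_spec hi hl hil⟩
    · have h5 : (mem.length : ℝ) ≤ 290 * (s.length * g) := by exact_mod_cast h2
      have h6 : (s.length : ℝ) * g ≤ s.length * (2 * lg s.length) :=
        mul_le_mul_of_nonneg_left hlg (Nat.cast_nonneg _)
      have h7 : 0 ≤ (s.length : ℝ) * lg s.length :=
        mul_nonneg (Nat.cast_nonneg _) (zero_le_one.trans (one_le_lg _))
      linarith
    · refine ⟨addr p, repeatList s p, h4.addr_eq p hp hp', pairwise_repeatList,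
        fun x => mem_repeatList, ?_⟩
      rw [← listBlock_eq]
      exact h3 p hp hp'
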